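/- Let $d\ge 1$ and consider one of two settings. (i) Periodic: $\Omega=\prod_{i=1}^d(0,\ell_i)$ with $\ell_i>0$, and $H^1(\Omega)$ denotes the Sobolev space $H^1_{per}(\Omega)$ of periodic functions. (ii) Neumann: $\Omega\subset\mathbb R^d$ is a bounded domain (open and connected) satisfying the interior cone condition (for instance a bounded Lipschitz domain), and $H^1(\Omega)$ is the usual Sobolev space. Let $\varepsilon,\delta t>0$, $0<\sigma<\tfrac12$, $\theta>1$, and let $F$ be the regularized Flory–Huggins potential $$F(s)=\begin{cases} s\ln s+\frac{(1-s)^2}{2\sigma}+(1-s)\ln\sigma-\frac\sigma2+\theta(s-s^2), & s\ge 1-\sigma,\\ s\ln s+(1-s)\ln(1-s)+\theta(s-s^2), & \sigma\le s\le 1-\sigma,\\ (1-s)\ln(1-s)+\frac{s^2}{2\sigma}+s\ln\sigma-\frac\sigma2+\theta(s-s^2), & s\le\sigma,\end{cases}$$ and let $B$ be a constant with $F(s)+B>0$ for all $s\in\mathbb R$. Let $M:\mathbb R\to\mathbb R$ be measurable with $0<L_2\le M(s)\le L_1$ for all $s$. Let $\phi^n,U^n\in L^2(\Omega)$ be given,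 and put $H^n=F'(\phi^n)/\sqrt{F(\phi^n)+B}$, $$P_1(\phi)=-\varepsilon^2\Delta\phi+\tfrac12(H^n)^2\phi,\qquad g_1^n=H^nU^n-\tfrac12(H^n)^2\phi^n.$$ Write $(\cdot,\cdot)$ for the $L^2(\Omega)$ inner product and $(P_1(\phi),w)=\varepsilon^2(\nabla\phi,\nabla w)+\tfrac12(H^n\phi,H^nw)$ for $\phi,w\in H^1(\Omega)$. **Theorem 3.1.** Consider the first-order scheme $$\frac{\phi^{n+1}-\phi^n}{\delta t}=\nabla\cdot\big(M(\phi^n)\nabla\mu^{n+1}\big),\qquad \mu^{n+1}=P_1(\phi^{n+1})+g_1^n,$$ with periodic boundary conditions in case (i) and $\partial_{\mathbf n}\phi^{n+1}=\partial_{\mathbf n}\mu^{n+1}=0$ on $\partial\Omega$ in case (ii), understood weakly: $\phi^{n+1},\mu^{n+1}\in H^1(\Omega)$ and, for all $w\in H^1(\Omega)$, $\frac1{\delta t}(\phi^{n+1}-\phi^n,w)=-(M(\phi^n)\nabla\mu^{n+1},\nabla w)$ and $(\mu^{n+1},w)=(P_1(\phi^{n+1}),w)+(g_1^n,w)$. 1.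 This linear system has a unique solution $(\phi^{n+1},\mu^{n+1})\in H^1(\Omega)\times H^1(\Omega)$, and $\int_\Omega\phi^{n+1}\,dx=\int_\Omega\phi^n\,dx$. 2. For every $u\in L^2(\Omega)$ with $\int_\Omega u=0$ there is a unique $v=Ru\in H^1(\Omega)$ with $\int_\Omega v=0$ and $-(M(\phi^n)\nabla v,\nabla w)=(u,w)$ for all $w\in H^1(\Omega)$, that is, $\nabla\cdot(M(\phi^n)\nabla v)=u$ with the given boundary conditions; the operator $R$ is linear and bounded. Let $V=\{\psi\in H^1(\Omega):\int_\Omega\psi=0\}$, and define $\mathbb A:V\to V'$ by $$\langle\mathbb A\psi,\chi\rangle=-\tfrac1{\delta t}(R\psi,\chi)+(P_1(\psi),\chi),\qquad \psi,\chi\in V.$$ Then $\mathbb A$ is bounded and is the linear operator of the system after elimination of $\mu^{n+1}$: with $\alpha=\frac1{|\Omega|}\int_\Omega\phi^n$, a function $\phi\in H^1(\Omega)$ is the first component of a solution of the system if and only if $\phi=\psi+\alpha$ for some $\psi\in V$ with $$\langle\mathbb A\psi,\chi\rangle=-\Big(R\tfrac{\phi^n-\alpha}{\delta t},\chi\Big)-\Big(g_1^n+\tfrac12(H^n)^2\alpha,\chi\Big)\quad\text{for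 all }\chi\in V.$$ 3. $\mathbb A$ is symmetric (self-adjoint), $\langle\mathbb A\psi,\chi\rangle=\langle\mathbb A\chi,\psi\rangle$ for all $\psi,\chi\in V$, and positive definite: $\langle\mathbb A\psi,\psi\rangle>0$ for $0\ne\psi\in V$, and moreover there is $C>0$ with $\langle\mathbb A\psi,\psi\rangle\ge C\|\psi\|_{H^1}^2$ for all $\psi\in V$. -/

import Mathlib

open MeasureTheory
open scoped ContDiff

noncomputable section

namespace CahnHilliardIEQ

/-- The ambient Euclidean space `ℝ^d`. -/
abbrev Space (d : ℕ) : Type := EuclideanSpace ℝ (Fin d)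

/-! ### Domains and boundary conditions -/

/-- The interior cone condition: every point of `Ω` is the vertex of a finite closed cone contained
in `Ω`, all these cones being congruent (height `h`, cosine `c` of the half-opening angle).  Every
bounded Lipschitz domain satisfies it. -/
def ConeCondition {d : ℕ} (Ω : Set (Space d)) : Prop :=
  ∃ h c : ℝ, 0 < h ∧ 0 < c ∧ c < 1 ∧
    ∀ x ∈ Ω, ∃ e : Space d, ‖e‖ = 1 ∧
      ∀ y : Space d, ‖y‖ ≤ h → c * ‖y‖ ≤ inner ℝ y e → x + y ∈ Ω

/-- A spatial domain together with one of the two boundary conditions: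
a box `∏ (0, ℓ i)` with periodic boundary conditions, or a bounded domain (open, connected,
satisfying the cone condition) with homogeneous Neumann boundary conditions. -/
inductive Geometry (d : ℕ) : Type
  | periodic (ℓ : Fin d → ℝ) (hℓ : ∀ i, 0 < ℓ i) : Geometry d
  | neumann (Ω : Set (Space d)) (isOpen : IsOpen Ω) (isConnected : IsConnected Ω)
      (isBounded : Bornology.IsBounded Ω) (cone : ConeCondition Ω) : Geometry d

/-- The underlying open set `Ω`. -/
def Geometry.domain {d : ℕ} : Geometry d → Set (Space d)
  | .periodic ℓ _ => {x | ∀ i, 0 < x i ∧ x i < ℓ i}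
  | .neumann Ω _ _ _ _ => Ω

/-- The test functions defining weak derivatives: smooth functions which are `ℓ i`-periodic in the
`i`-th variable in the periodic case, smooth functions with compact support in `Ω` in the Neumann
case. -/
def Geometry.testFunctions {d : ℕ} : Geometry d → Set (Space d → ℝ)
  | .periodic ℓ _ => {χ | ContDiff ℝ ∞ χ ∧
      ∀ (i : Fin d) (x : Space d), χ (x + EuclideanSpace.single i (ℓ i)) = χ x}
  | .neumann Ω _ _ _ _ => {χ | ContDiff ℝ ∞ χ ∧ HasCompactSupport χ ∧ tsupport χ ⊆ Ω}

/-- Lebesgue measure on `Ω`. -/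
abbrev Geometry.vol {d : ℕ} (G : Geometry d) : Measure (Space d) := volume.restrict G.domain

theorem Geometry.isBounded_domain {d : ℕ} (G : Geometry d) : Bornology.IsBounded G.domain := by
  cases G with
  | neumann Ω _ _ hb _ => exact hb
  | periodic ℓ hℓ =>
    have h : Bornology.IsBounded (Set.pi Set.univ fun i => Set.Icc 0 (ℓ i)) :=
      (isCompact_univ_pi fun i => isCompact_Icc).isBounded
    have h2 := (EuclideanSpace.equiv (Fin d) ℝ).antilipschitz.isBounded_preimage h
    refine h2.subset fun x hx => ?_
    intro i _
    exact ⟨(hx i).1.le, (hx i).2.le⟩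

instance {d : ℕ} (G : Geometry d) : IsFiniteMeasure G.vol :=
  ⟨by simpa using G.isBounded_domain.measure_lt_top⟩

theorem Geometry.contDiff_of_mem {d : ℕ} (G : Geometry d) {χ : Space d → ℝ}
    (hχ : χ ∈ G.testFunctions) : ContDiff ℝ ∞ χ := by
  cases G with
  | neumann => exact hχ.1
  | periodic => exact hχ.1

theorem Geometry.memLp_of_continuous {d : ℕ} (G : Geometry d) {f : Space d → ℝ}
    (hf : Continuous f) : MemLp f 2 G.vol := by
  obtain ⟨C, hC⟩ := G.isBounded_domain.isCompact_closure.exists_bound_of_continuousOn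
    hf.continuousOn
  refine MemLp.of_bound hf.aestronglyMeasurable C ?_
  refine ae_restrict_of_ae_restrict_of_subset subset_closure ?_
  exact ae_restrict_of_forall_mem isClosed_closure.measurableSet hC

/-! ### The spaces `L²(Ω)` and `H¹(Ω)` -/

/-- `L²(Ω)`. -/
abbrev L2 {d : ℕ} (G : Geometry d) : Type := Lp ℝ 2 G.vol

/-- `L²(Ω)^d`. -/
abbrev L2Vec {d : ℕ} (G : Geometry d) : Type := Lp (Space d) 2 G.vol

/-- `g` is the weak gradient of `u`. -/
def HasWeakGradient {d : ℕ} (G : Geometry d) (u : L2 G) (g : L2Vec G) : Prop :=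
  ∀ χ ∈ G.testFunctions, ∀ i : Fin d,
    ∫ x in G.domain, u x * fderiv ℝ χ x (EuclideanSpace.single i 1)
      = -∫ x in G.domain, g x i * χ x

theorem integrable_fst {d : ℕ} (G : Geometry d) {χ : Space d → ℝ} (hχ : χ ∈ G.testFunctions)
    (i : Fin d) (u : L2 G) :
    Integrable (fun x => u x * fderiv ℝ χ x (EuclideanSpace.single i 1)) G.vol := by
  have hc : Continuous fun x => fderiv ℝ χ x (EuclideanSpace.single i 1) :=
    ((G.contDiff_of_mem hχ).continuous_fderiv (by simp)).clm_apply continuous_const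
  exact (Lp.memLp u).integrable_mul (G.memLp_of_continuous hc)

theorem integrable_snd {d : ℕ} (G : Geometry d) {χ : Space d → ℝ} (hχ : χ ∈ G.testFunctions)
    (i : Fin d) (g : L2Vec G) : Integrable (fun x => g x i * χ x) G.vol := by
  have h1 : MemLp (fun x => g x i) 2 G.vol :=
    (EuclideanSpace.proj (𝕜 := ℝ) i : Space d →L[ℝ] ℝ).comp_memLp' (Lp.memLp g)
  exact h1.integrable_mul (G.memLp_of_continuous (G.contDiff_of_mem hχ).continuous)

/-- The Sobolev space `H¹(Ω)` (its periodic version `H¹_per(Ω)` for periodic boundary conditions),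
as the space of pairs `(u, ∇u)` in `L²(Ω) × L²(Ω)^d` with `∇u` the weak gradient of `u`.  Its inner
product is `(u, v) + (∇u, ∇v)`. -/
def H1 {d : ℕ} (G : Geometry d) : Submodule ℝ (WithLp 2 (L2 G × L2Vec G)) where
  carrier := {p | HasWeakGradient G p.fst p.snd}
  zero_mem' := by
    intro χ hχ i
    have h1 : ∫ x in G.domain, (0 : L2 G) x * fderiv ℝ χ x (EuclideanSpace.single i 1) = 0 := by
      rw [← integral_zero (Space d) ℝ (μ := G.vol)]
      refine integral_congr_ae ?_
      filter_upwards [Lp.coeFn_zero ℝ 2 G.vol] with x hx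
      simp only [hx, Pi.zero_apply, zero_mul]
    have h2 : ∫ x in G.domain, (0 : L2Vec G) x i * χ x = 0 := by
      rw [← integral_zero (Space d) ℝ (μ := G.vol)]
      refine integral_congr_ae ?_
      filter_upwards [Lp.coeFn_zero (Space d) 2 G.vol] with x hx
      simp only [hx, Pi.zero_apply, PiLp.zero_apply, zero_mul]
    exact h1.trans (by rw [← neg_zero, ← h2]; rfl)
  add_mem' := by
    intro p q hp hq χ hχ i
    have h1 : ∫ x in G.domain, (p.fst + q.fst : L2 G) x *
          fderiv ℝ χ x (EuclideanSpace.single i 1)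
        = (∫ x in G.domain, p.fst x * fderiv ℝ χ x (EuclideanSpace.single i 1))
          + ∫ x in G.domain, q.fst x * fderiv ℝ χ x (EuclideanSpace.single i 1) := by
      rw [← integral_add (integrable_fst G hχ i _) (integrable_fst G hχ i _)]
      refine integral_congr_ae ?_
      filter_upwards [Lp.coeFn_add p.fst q.fst] with x hx
      simp only [hx, Pi.add_apply, add_mul]
    have h2 : ∫ x in G.domain, (p.snd + q.snd : L2Vec G) x i * χ x
        = (∫ x in G.domain, p.snd x i * χ x) + ∫ x in G.domain, q.snd x i * χ x := by
      rw [← integral_add (integrable_snd G hχ i _) (integrable_snd G hχ i _)]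
      refine integral_congr_ae ?_
      filter_upwards [Lp.coeFn_add p.snd q.snd] with x hx
      simp only [hx, Pi.add_apply, PiLp.add_apply, add_mul]
    refine h1.trans ?_
    rw [hp χ hχ i, hq χ hχ i, ← neg_add, ← h2]
    rfl
  smul_mem' := by
    intro c p hp χ hχ i
    have h1 : ∫ x in G.domain, (c • p.fst : L2 G) x *
          fderiv ℝ χ x (EuclideanSpace.single i 1)
        = c * ∫ x in G.domain, p.fst x * fderiv ℝ χ x (EuclideanSpace.single i 1) := by
      rw [← integral_const_mul]
      refine integral_congr_ae ?_
      filter_upwards [Lp.coeFn_smul c p.fst] with x hx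
      simp only [hx, Pi.smul_apply, smul_eq_mul, mul_assoc]
    have h2 : ∫ x in G.domain, (c • p.snd : L2Vec G) x i * χ x
        = c * ∫ x in G.domain, p.snd x i * χ x := by
      rw [← integral_const_mul]
      refine integral_congr_ae ?_
      filter_upwards [Lp.coeFn_smul c p.snd] with x hx
      simp only [hx, Pi.smul_apply, PiLp.smul_apply, smul_eq_mul, mul_assoc]
    refine h1.trans ?_
    rw [hp χ hχ i, mul_neg, ← h2]
    rfl

/-- The element `u` of `L²(Ω)` underlying an element of `H¹(Ω)`. -/
def fn {d : ℕ} {G : Geometry d} (u : H1 G) : L2 G := u.1.fst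

/-- The weak gradient of an element of `H¹(Ω)`. -/
def wgrad {d : ℕ} {G : Geometry d} (u : H1 G) : L2Vec G := u.1.snd

/-- The functions of `L²(Ω)` with integral zero. -/
def L2MeanFree {d : ℕ} (G : Geometry d) : Submodule ℝ (L2 G) where
  carrier := {u | ∫ x in G.domain, u x = 0}
  zero_mem' := by
    change ∫ x in G.domain, (0 : L2 G) x = 0
    rw [integral_congr_ae (Lp.coeFn_zero ℝ 2 G.vol)]
    simp
  add_mem' := by
    intro u v hu hv
    change ∫ x in G.domain, (u + v : L2 G) x = 0
    rw [integral_congr_ae (Lp.coeFn_add u v)]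
    have h := integral_add ((Lp.memLp u).integrable one_le_two)
      ((Lp.memLp v).integrable one_le_two)
    refine h.trans ?_
    rw [show ∫ x in G.domain, u x = 0 from hu, show ∫ x in G.domain, v x = 0 from hv, add_zero]
  smul_mem' := by
    intro c u hu
    change ∫ x in G.domain, (c • u : L2 G) x = 0
    rw [integral_congr_ae (Lp.coeFn_smul c u)]
    refine (integral_const_mul c _).trans ?_
    rw [show ∫ x in G.domain, u x = 0 from hu, mul_zero]

/-- The functions of `H¹(Ω)` with integral zero. -/
def H1MeanFree {d : ℕ} (G : Geometry d) : Submodule ℝ (H1 G) where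
  carrier := {u | fn u ∈ L2MeanFree G}
  zero_mem' := (L2MeanFree G).zero_mem
  add_mem' := fun hu hv => (L2MeanFree G).add_mem hu hv
  smul_mem' := fun c _ hu => (L2MeanFree G).smul_mem c hu

/-- The inclusion of the mean-free part of `H¹(Ω)` into that of `L²(Ω)`. -/
def toL2MeanFree {d : ℕ} {G : Geometry d} (u : H1MeanFree G) : L2MeanFree G := ⟨fn u.1, u.2⟩

/-- The mean value `|Ω|⁻¹ ∫_Ω u`. -/
def mean {d : ℕ} {G : Geometry d} (u : L2 G) : ℝ := ⨍ x in G.domain, u x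

/-- The mean-free part `u - |Ω|⁻¹ ∫_Ω u`, as a mean-free element of `L²(Ω)`. -/
def meanFree {d : ℕ} {G : Geometry d} (u : L2 G) : L2MeanFree G :=
  ⟨u - Lp.const 2 G.vol (mean u), by
    change ∫ x in G.domain, (u - Lp.const 2 G.vol (mean u) : L2 G) x = 0
    rw [integral_congr_ae (Lp.coeFn_sub u (Lp.const 2 G.vol (mean u)))]
    refine (integral_sub ((Lp.memLp u).integrable one_le_two)
      ((Lp.memLp _).integrable one_le_two)).trans ?_
    rw [integral_congr_ae (Lp.coeFn_const 2 G.vol (mean u))]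
    have h := integral_average G.vol (fun x => u x)
    simp only [Function.const_apply, mean]
    rw [h, sub_self]⟩

/-! ### The potential and the mobility -/

/-- The regularized logarithmic Flory–Huggins potential. -/
def potential (σ θ s : ℝ) : ℝ :=
  if 1 - σ ≤ s then
    s * Real.log s + (1 - s) ^ 2 / (2 * σ) + (1 - s) * Real.log σ - σ / 2 + θ * (s - s ^ 2)
  else if σ ≤ s then
    s * Real.log s + (1 - s) * Real.log (1 - s) + θ * (s - s ^ 2)
  else
    (1 - s) * Real.log (1 - s) + s ^ 2 / (2 * σ) + s * Real.log σ - σ / 2 + θ * (s - s ^ 2)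

/-- `H(s) = f(s) / √(F(s) + B)` with `f = F'` (`F` is continuously differentiable). -/
def coeffH (σ θ B s : ℝ) : ℝ :=
  deriv (potential σ θ) s / Real.sqrt (potential σ θ s + B)

/-- The regularized (non-degenerate) mobility. -/
def regMobility (σ s : ℝ) : ℝ :=
  if 0 ≤ s ∧ s ≤ 1 then (1 - (1 - σ) * (2 * s - 1) ^ 2) / 4
  else σ / 8 * (1 + Real.exp (-2 * (1 - σ) * ((2 * s - 1) ^ 2 - 1) / σ))

/-- Admissible mobilities: measurable, bounded, and bounded below by a positive constant. -/
def IsAdmissibleMobility (M : ℝ → ℝ) : Prop :=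
  Measurable M ∧ ∃ L₁ L₂ : ℝ, 0 < L₂ ∧ ∀ s, L₂ ≤ M s ∧ M s ≤ L₁

/-- The regularized mobility is admissible. -/
theorem isAdmissibleMobility_regMobility {σ : ℝ} (h0 : 0 < σ) (h1 : σ < 1) :
    IsAdmissibleMobility (regMobility σ) := by
  refine ⟨?_, 1, σ / 8, by positivity, fun s => ?_⟩
  · unfold regMobility
    refine Measurable.ite (measurableSet_Icc (a := (0 : ℝ)) (b := 1)) ?_ ?_ <;> fun_prop
  · unfold regMobility
    split_ifs with h
    · have h2 : (2 * s - 1) ^ 2 ≤ 1 := by nlinarith [h.1, h.2]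
      constructor <;> nlinarith [sq_nonneg (2 * s - 1)]
    · have h2 : 1 ≤ (2 * s - 1) ^ 2 := by
        by_contra h3
        push Not at h3
        exact h ⟨by nlinarith, by nlinarith⟩
      have h4 : Real.exp (-2 * (1 - σ) * ((2 * s - 1) ^ 2 - 1) / σ) ≤ 1 := by
        refine Real.exp_le_one_iff.2 (div_nonpos_of_nonpos_of_nonneg ?_ h0.le)
        nlinarith
      have h5 := Real.exp_pos (-2 * (1 - σ) * ((2 * s - 1) ^ 2 - 1) / σ)
      constructor <;> nlinarith

/-! ### The backward Euler IEQ step -/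

/-- The weighted Dirichlet form `(M(φⁿ) ∇v, ∇w)`. -/
def diffusionForm {d : ℕ} {G : Geometry d} (M : ℝ → ℝ) (φn : L2 G) (v w : H1 G) : ℝ :=
  ∫ x in G.domain, M (φn x) * inner ℝ (wgrad v x) (wgrad w x)

/-- The weak form `(P₁(φ), w)` of `P₁(φ) = -ε² Δφ + ½ Hⁿ Hⁿ φ`. -/
def P1Form {d : ℕ} {G : Geometry d} (ε σ θ B : ℝ) (φn : L2 G) (φ w : H1 G) : ℝ :=
  ε ^ 2 * (∫ x in G.domain, inner ℝ (wgrad φ x) (wgrad w x))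
    + 1 / 2 * ∫ x in G.domain,
        (coeffH σ θ B (φn x) * fn φ x) * (coeffH σ θ B (φn x) * fn w x)

/-- The explicit term `g₁ⁿ = Hⁿ Uⁿ - ½ Hⁿ Hⁿ φⁿ`. -/
def g1 {d : ℕ} {G : Geometry d} (σ θ B : ℝ) (φn Un : L2 G) (x : Space d) : ℝ :=
  coeffH σ θ B (φn x) * Un x - 1 / 2 * coeffH σ θ B (φn x) ^ 2 * φn x

/-- `(φ, μ) ∈ H¹(Ω) × H¹(Ω)` is a (weak) solution of
`(φ - φⁿ)/δt = ∇·(M(φⁿ)∇μ)`, `μ = P₁(φ) + g₁ⁿ`, with the boundary conditions encoded in `G`. -/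
def IsStepSolution {d : ℕ} {G : Geometry d} (M : ℝ → ℝ) (ε δt σ θ B : ℝ) (φn Un : L2 G)
    (φ μ : H1 G) : Prop :=
  (∀ w : H1 G, ∫ x in G.domain, (fn φ x - φn x) / δt * fn w x = -diffusionForm M φn μ w) ∧
  (∀ w : H1 G, ∫ x in G.domain, fn μ x * fn w x
    = P1Form ε σ θ B φn φ w + ∫ x in G.domain, g1 σ θ B φn Un x * fn w x)

/-- `v` is the weak solution with integral zero of `∇·(M(φⁿ)∇v) = u` under the boundary conditions
encoded in `G`. -/
def IsInverseLaplacian {d : ℕ} {G : Geometry d} (M : ℝ → ℝ) (φn : L2 G) (u : L2MeanFree G)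
    (v : H1MeanFree G) : Prop :=
  ∀ w : H1 G, -diffusionForm M φn v.1 w = ∫ x in G.domain, u.1 x * fn w x

/-- The weak form `(𝔸ψ, χ)`, for mean-free `ψ` and `χ`, of
`𝔸ψ = -(1/δt) R ψ + P₁(ψ) - β`, where `R` is the weighted inverse Laplacian; the constant `β` is
orthogonal to every mean-free `χ`. -/
def reducedForm {d : ℕ} {G : Geometry d} (ε δt σ θ B : ℝ) (φn : L2 G)
    (R : L2MeanFree G →L[ℝ] H1MeanFree G) (ψ χ : H1MeanFree G) : ℝ :=
  -(1 / δt) * (∫ x in G.domain, fn (R (toL2MeanFree ψ)).1 x * fn χ.1 x) + P1Form ε σ θ B φn ψ.1 χ.1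

/-- The weak form `(b, χ)`, for mean-free `χ`, of the right-hand side `b = -R fⁿ - ĝ`, with
`fⁿ = (φⁿ - α)/δt`, `ĝ = g₁ⁿ + ½ Hⁿ Hⁿ α` and `α` the mean value of `φⁿ`. -/
def reducedRhs {d : ℕ} {G : Geometry d} (δt σ θ B : ℝ) (φn Un : L2 G)
    (R : L2MeanFree G →L[ℝ] H1MeanFree G) (χ : H1MeanFree G) : ℝ :=
  -(∫ x in G.domain, fn (R ((1 / δt) • meanFree φn)).1 x * fn χ.1 x)
    - ∫ x in G.domain,
        (g1 σ θ B φn Un x + 1 / 2 * coeffH σ θ B (φn x) ^ 2 * mean φn) * fn χ.1 x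

end CahnHilliardIEQ

end

open CahnHilliardIEQ

/-!
The scheme is a linear elliptic system which the weighted inverse Laplacian decouples, and every
solvability statement is an instance of the Lax–Milgram theorem on the mean-free part `V` of
`H¹(Ω)`. Three analytic facts make this work.

*Poincaré–Wirtinger inequality* (`exists_norm_fn_le_norm_wgrad`). For a fixed translation `h`,
differentiating `s ↦ ∫ U(z) χ(z - s h) dz` gives `‖U(· + h) - U‖ ≤ ‖h‖ ‖∇U‖` in `L²` of the points
`x` whose segment to `x + h` stays in `Ω`
(`IsWeakGradientOn.lintegral_translate_le`). Integrating over `h` bounds the mutual oscillation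
`∫_A ∫_B |U(x) - U(y)|²` of two sets all of whose connecting segments lie in `Ω`
(`oscillationBound_of_segments`). A periodic box is convex, and one application suffices. Under the
cone condition every point sees a ball of fixed radius, finitely many balls serve all points, and
since `Ω` is connected any two small balls are linked by a chain of balls; such bounds compose
along sets of positive measure (`OscillationBound.trans`). For a function of mean zero the
oscillation over `Ω × Ω` dominates `|Ω| ‖u‖²`. No compact embedding is needed.

*Boundedness of `H = F' / √(F + B)`* (`exists_abs_coeffH_le`). The slopes of `F'` are bounded
above and `F + B` is positive, and a nonnegative function `f` with `f'' ≤ L` satisfies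
`f'² ≤ 2 L f`.

*Constants lie in `H¹(Ω)`* (`constH1`). In the periodic case this says that partial derivatives of
periodic functions have integral zero over the box, which is the divergence theorem. Hence
`H¹(Ω) = V ⊕ ℝ`, and each equation of the system may be tested separately with mean-free functions
and with `1`.

Testing the mass balance with `1` gives conservation of mass; with mean-free functions it says that
the mean-free part of `μ` is `R ((φ - φⁿ) / δt)` (`mass_equation_iff`). Substituting this in the
equation for `μ` leaves `A ψ = b` for `ψ = φ - α`, while testing that equation with `1` fixes the
mean of `μ`. Since `-(R ψ, χ) = (M ∇R ψ, ∇R χ)`, the operator `A` is symmetric and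
`⟨A ψ, ψ⟩ ≥ ε² ‖∇ψ‖²`, which is coercive by the Poincaré inequality.
-/

namespace CahnHilliardIEQ

/-! ### The coefficient `H = F' / √(F + B)` is bounded -/

/-- A nonnegative function on the line whose derivative has slope at most `L` satisfies
`F'² ≤ 2 L F`. -/
theorem sq_deriv_le_of_nonneg {f f' : ℝ → ℝ} {L : ℝ} (hL : 0 < L)
    (hf : ∀ x, HasDerivAt f (f' x) x) (hL' : ∀ x y, x ≤ y → f' y - f' x ≤ L * (y - x))
    (h0 : ∀ x, 0 ≤ f x) (x : ℝ) : f' x ^ 2 ≤ 2 * L * f x := by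
  -- `k t = f x + f' x * (t - x) + L / 2 * (t - x) ^ 2 - f t` has monotone derivative, hence its
  -- critical point `x` is a minimum; then evaluate at the vertex `t = x - f' x / L`
  have hk : ∀ t, HasDerivAt (fun t => f x + f' x * (t - x) + L / 2 * (t - x) ^ 2 - f t)
      (f' x + L * (t - x) - f' t) t := fun t => by
    have h1 : HasDerivAt (fun t : ℝ => t - x) 1 t := (hasDerivAt_id t).sub_const x
    have h2 := (((h1.const_mul (f' x)).const_add (f x)).add ((h1.pow 2).const_mul (L / 2))).sub
      (hf t)
    refine h2.congr_deriv ?_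
    push_cast
    ring
  have hconv : ConvexOn ℝ Set.univ
      (fun t => f x + f' x * (t - x) + L / 2 * (t - x) ^ 2 - f t) := by
    refine Monotone.convexOn_univ_of_deriv (fun t => (hk t).differentiableAt) ?_
    intro s t hst
    rw [(hk s).deriv, (hk t).deriv]
    linarith [hL' s t hst]
  have hmin := hconv.isMinOn_of_rightDeriv_eq_zero (x := x) (by simp)
    (by rw [((hk x).hasDerivWithinAt).derivWithin (uniqueDiffWithinAt_Ioi x)]; ring)
  have h1 := hmin (Set.mem_univ (x - f' x / L))
  simp only [Set.mem_ofPred_eq] at h1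
  have h2 := h0 (x - f' x / L)
  have h3 : f' x * (x - f' x / L - x) + L / 2 * (x - f' x / L - x) ^ 2
      = - (f' x ^ 2 / (2 * L)) := by
    field_simp
    ring
  have h4 : f' x ^ 2 / (2 * L) ≤ f x := by
    have : x - x = 0 := sub_self x
    simp only [this] at h1
    nlinarith
  rwa [div_le_iff₀ (by positivity), mul_comm] at h4

/-- The convex building block of the potential: `s log s` for `s ≥ σ`, continued below `σ` by its
second order Taylor polynomial at `σ`. -/
noncomputable def regEntropy (σ s : ℝ) : ℝ :=
  if σ ≤ s then s * Real.log s else s ^ 2 / (2 * σ) + s * Real.log σ - σ / 2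

/-- The derivative of `regEntropy σ`. -/
noncomputable def regEntropyDeriv (σ s : ℝ) : ℝ :=
  if σ ≤ s then Real.log s + 1 else s / σ + Real.log σ

theorem potential_eq_regEntropy {σ : ℝ} (θ : ℝ) (hσ' : σ < 1 / 2) (s : ℝ) :
    potential σ θ s = regEntropy σ s + regEntropy σ (1 - s) + θ * (s - s ^ 2) := by
  unfold potential regEntropy
  rcases lt_trichotomy (1 - σ) s with h | h | h
  · rw [if_pos h.le, if_pos (by linarith), if_neg (by linarith)]
    ring
  · subst h
    rw [if_pos le_rfl, if_pos (by linarith), if_pos (by linarith)]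
    have : 1 - (1 - σ) = σ := by ring
    rw [this]
    field_simp
    ring
  · rw [if_neg (not_le.2 h), if_pos (show σ ≤ 1 - s by linarith)]
    split_ifs <;> ring

theorem hasDerivAt_regEntropy {σ : ℝ} (hσ : 0 < σ) (s : ℝ) :
    HasDerivAt (regEntropy σ) (regEntropyDeriv σ s) s := by
  have hlog : ∀ t, 0 < t → HasDerivAt (fun s => s * Real.log s) (Real.log t + 1) t :=
    fun t ht => Real.hasDerivAt_mul_log ht.ne'
  have hquad : ∀ t, HasDerivAt (fun s => s ^ 2 / (2 * σ) + s * Real.log σ - σ / 2)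
      (t / σ + Real.log σ) t := fun t => by
    have h := ((((hasDerivAt_id t).pow 2).div_const (2 * σ)).add
      ((hasDerivAt_id t).mul_const (Real.log σ))).sub_const (σ / 2)
    refine h.congr_deriv ?_
    simp only [id]
    field_simp
    push_cast
    ring
  rcases lt_trichotomy s σ with h | h | h
  · have : regEntropyDeriv σ s = s / σ + Real.log σ := if_neg (not_le.2 h)
    rw [this]
    refine (hquad s).congr_of_eventuallyEq ?_
    filter_upwards [Iio_mem_nhds h] with t ht
    exact if_neg (not_le.2 ht)
  · subst h
    have : regEntropyDeriv s s = Real.log s + 1 := if_pos le_rfl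
    rw [this]
    -- the two branches have the same value and derivative at the junction
    have hr : HasDerivWithinAt (regEntropy s) (Real.log s + 1) (Set.Ici s) s :=
      (hlog s hσ).hasDerivWithinAt.congr (fun t ht => if_pos ht) (if_pos le_rfl)
    have hval : regEntropy s s = s ^ 2 / (2 * s) + s * Real.log s - s / 2 := by
      rw [regEntropy, if_pos le_rfl]
      field_simp
      ring
    have hl : HasDerivWithinAt (regEntropy s) (s / s + Real.log s) (Set.Iio s) s :=
      (hquad s).hasDerivWithinAt.congr (fun t ht => if_neg (not_le.2 ht)) hval
    rw [div_self hσ.ne', add_comm] at hl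
    have := hl.union hr
    rwa [Set.Iio_union_Ici, hasDerivWithinAt_univ] at this
  · have : regEntropyDeriv σ s = Real.log s + 1 := if_pos h.le
    rw [this]
    refine (hlog s (hσ.trans h)).congr_of_eventuallyEq ?_
    filter_upwards [Ioi_mem_nhds h] with t ht
    exact if_pos (le_of_lt ht)

theorem regEntropyDeriv_sub_le {σ : ℝ} (hσ : 0 < σ) {x y : ℝ} (hxy : x ≤ y) :
    0 ≤ regEntropyDeriv σ y - regEntropyDeriv σ x ∧
      regEntropyDeriv σ y - regEntropyDeriv σ x ≤ 1 / σ * (y - x) := by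
  -- the slope of `log` on `[σ, ∞)` lies between `0` and `1 / σ`
  have hlog : ∀ {a b : ℝ}, σ ≤ a → a ≤ b →
      0 ≤ Real.log b - Real.log a ∧ Real.log b - Real.log a ≤ 1 / σ * (b - a) := by
    intro a b ha hab
    have ha0 : 0 < a := hσ.trans_le ha
    refine ⟨sub_nonneg.2 (Real.log_le_log ha0 hab), ?_⟩
    rw [← Real.log_div (ha0.trans_le hab).ne' ha0.ne']
    have h1 := Real.log_le_sub_one_of_pos (div_pos (ha0.trans_le hab) ha0)
    have h2 : b / a - 1 = 1 / a * (b - a) := by field_simp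
    have h3 : 1 / a * (b - a) ≤ 1 / σ * (b - a) :=
      mul_le_mul_of_nonneg_right (one_div_le_one_div_of_le hσ ha) (sub_nonneg.2 hab)
    linarith
  have hlin : ∀ a b : ℝ, b / σ - a / σ = 1 / σ * (b - a) := fun a b => by field_simp
  have hpos : 0 < 1 / σ := by positivity
  have hone : σ / σ = 1 := div_self hσ.ne'
  unfold regEntropyDeriv
  split_ifs with h1 h2 h2
  · have := hlog h2 hxy
    constructor <;> linarith
  · have h3 := hlog le_rfl h1
    have h4 := hlin x σ
    have h5 : 0 ≤ 1 / σ * (σ - x) := mul_nonneg hpos.le (by linarith)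
    constructor <;> nlinarith
  · exact absurd (h2.trans hxy) h1
  · have h4 := hlin x y
    have h5 : 0 ≤ 1 / σ * (y - x) := mul_nonneg hpos.le (by linarith)
    constructor <;> linarith

theorem hasDerivAt_potential {σ : ℝ} (θ : ℝ) (hσ : 0 < σ) (hσ' : σ < 1 / 2) (s : ℝ) :
    HasDerivAt (potential σ θ)
      (regEntropyDeriv σ s - regEntropyDeriv σ (1 - s) + θ * (1 - 2 * s)) s := by
  have h1 : potential σ θ
      = fun s => regEntropy σ s + regEntropy σ (1 - s) + θ * (s - s ^ 2) :=
    funext (potential_eq_regEntropy θ hσ')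
  rw [h1]
  have h2 : HasDerivAt (fun s : ℝ => 1 - s) (-1) s := (hasDerivAt_id s).const_sub 1
  have h3 : HasDerivAt (fun s => regEntropy σ (1 - s)) (regEntropyDeriv σ (1 - s) * -1) s :=
    (hasDerivAt_regEntropy hσ (1 - s)).comp s h2
  refine (((hasDerivAt_regEntropy hσ s).add h3).add
    (((hasDerivAt_id s).sub ((hasDerivAt_id s).pow 2)).const_mul θ)).congr_deriv ?_
  simp only [id]
  push_cast
  ring

/-- `H` is bounded for every admissible `B`: `F'` is Lipschitz and `F + B` is positive, so
`F'² ≤ C (F + B)`. -/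
theorem exists_abs_coeffH_le {σ θ B : ℝ} (hσ : 0 < σ) (hσ' : σ < 1 / 2) (hθ : 1 < θ)
    (hB : ∀ s : ℝ, 0 < potential σ θ s + B) : ∃ K : ℝ, ∀ s, |coeffH σ θ B s| ≤ K := by
  have hL : 0 < 2 / σ := by positivity
  refine ⟨Real.sqrt (2 * (2 / σ)), fun s => ?_⟩
  have h := sq_deriv_le_of_nonneg hL (f := fun s => potential σ θ s + B)
    (f' := fun s => regEntropyDeriv σ s - regEntropyDeriv σ (1 - s) + θ * (1 - 2 * s))
    (fun x => (hasDerivAt_potential θ hσ hσ' x).add_const B) ?_ (fun x => (hB x).le) s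
  · rw [← (hasDerivAt_potential θ hσ hσ' s).deriv] at h
    refine Real.abs_le_sqrt ?_
    rw [coeffH, div_pow, Real.sq_sqrt (hB s).le, div_le_iff₀ (hB s)]
    exact h
  · intro x y hxy
    have h1 := (regEntropyDeriv_sub_le hσ hxy).2
    have h2 := (regEntropyDeriv_sub_le hσ (sub_le_sub_left hxy 1)).2
    have h3 : 2 / σ * (y - x) = 1 / σ * (y - x) + 1 / σ * (1 - x - (1 - y)) := by ring
    have h4 : 0 ≤ θ * (y - x) := mul_nonneg (by linarith) (by linarith)
    linarith

theorem measurable_coeffH {σ θ B : ℝ} (hσ : 0 < σ) (hσ' : σ < 1 / 2) :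
    Measurable (coeffH σ θ B) := by
  have h : Differentiable ℝ (potential σ θ) :=
    fun s => (hasDerivAt_potential θ hσ hσ' s).differentiableAt
  exact (measurable_deriv _).div ((h.continuous.measurable.add_const B).sqrt)

/-! ### Finite differences of weakly differentiable functions -/

section Translation

open scoped ENNReal Topology

variable {E : Type*} [NormedAddCommGroup E] [InnerProductSpace ℝ E] [FiniteDimensional ℝ E]
  [MeasurableSpace E] [BorelSpace E]

/-- The function `U` is weakly differentiable in the open set `Ω`, with weak gradient `g`; both are
globally defined and globally square integrable (in applications, extended by zero). -/
structure IsWeakGradientOn (Ω : Set E) (U : E → ℝ) (g : E → E) : Prop where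
  measurable : Measurable U
  memLp : MemLp U 2 volume
  memLp_grad : MemLp g 2 volume
  integral_eq : ∀ χ : E → ℝ, ContDiff ℝ ∞ χ → HasCompactSupport χ → tsupport χ ⊆ Ω → ∀ v : E,
    ∫ x, U x * fderiv ℝ χ x v = -∫ x, inner ℝ (g x) v * χ x

theorem abs_integral_mul_le_eLpNorm {X : Type*} [MeasurableSpace X] {μ : Measure X} {a b : X → ℝ}
    (ha : MemLp a 2 μ) (hb : MemLp b 2 μ) :
    |∫ x, a x * b x ∂μ| ≤ (eLpNorm a 2 μ).toReal * (eLpNorm b 2 μ).toReal := by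
  have h := abs_real_inner_le_norm (ha.toLp a) (hb.toLp b)
  rw [Lp.norm_toLp, Lp.norm_toLp, L2.inner_def] at h
  refine le_of_eq_of_le ?_ h
  congr 1
  refine integral_congr_ae ?_
  filter_upwards [ha.coeFn_toLp, hb.coeFn_toLp] with x h1 h2
  rw [h1, h2]
  simp [mul_comm]

omit [FiniteDimensional ℝ E] [MeasurableSpace E] [BorelSpace E] in
theorem eLpNorm_inner_const_toReal_le {X : Type*} [MeasurableSpace X] {μ : Measure X} {g : X → E}
    (hg : MemLp g 2 μ) (v : E) :
    (eLpNorm (fun x => inner ℝ (g x) v) 2 μ).toReal ≤ ‖v‖ * (eLpNorm g 2 μ).toReal := by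
  have h := eLpNorm_le_mul_eLpNorm_of_ae_le_mul (μ := μ) (f := fun x => inner ℝ (g x) v) (g := g)
    (c := ‖v‖) (Filter.Eventually.of_forall fun x => by
      rw [mul_comm]; exact norm_inner_le_norm _ _) 2
  have h2 := ENNReal.toReal_mono (ENNReal.mul_ne_top ENNReal.ofReal_ne_top hg.eLpNorm_ne_top) h
  rwa [ENNReal.toReal_mul, ENNReal.toReal_ofReal (norm_nonneg v)] at h2

/-- The set of points from which one can move by `h` along a segment inside `Ω`. -/
def segmentCore (Ω : Set E) (h : E) : Set E := {x | ∀ s ∈ Set.Icc (0 : ℝ) 1, x + s • h ∈ Ω}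

omit [FiniteDimensional ℝ E] [MeasurableSpace E] [BorelSpace E] in
theorem isOpen_segmentCore {Ω : Set E} (hΩ : IsOpen Ω) (h : E) : IsOpen (segmentCore Ω h) := by
  rw [isOpen_iff_eventually]
  intro x hx
  refine isCompact_Icc.eventually_forall_of_forall_eventually fun s hs => ?_
  have hc : Continuous fun p : E × ℝ => p.1 + p.2 • h := by fun_prop
  exact hc.continuousAt.eventually (hΩ.mem_nhds (hx s hs))

/-- Weak form of the estimate of a finite difference by the gradient: differentiate
`s ↦ ∫ U(z) χ(z - s h) dz`. -/
theorem IsWeakGradientOn.abs_integral_translate_le {Ω : Set E} {U : E → ℝ} {g : E → E}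
    (hU : IsWeakGradientOn Ω U g) (h : E) {χ : E → ℝ} (hχ : ContDiff ℝ ∞ χ)
    (hχc : HasCompactSupport χ) (hχs : tsupport χ ⊆ segmentCore Ω h) :
    |∫ x, (U (x + h) - U x) * χ x|
      ≤ ‖h‖ * (eLpNorm g 2 volume).toReal * (eLpNorm χ 2 volume).toReal := by
  have hUloc : LocallyIntegrable U volume := hU.memLp.locallyIntegrable one_le_two
  set χ' : E → ℝ := fun y => χ (-y) with hχ'
  have hχ'd : ContDiff ℝ ∞ χ' := hχ.comp contDiff_neg
  have hχ'c : HasCompactSupport χ' := hχc.comp_homeomorph (Homeomorph.neg E)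
  have hχ'f : ∀ y v, fderiv ℝ χ' y v = -fderiv ℝ χ (-y) v := fun y v => by
    have h1 : HasFDerivAt χ' ((fderiv ℝ χ (-y)).comp (-ContinuousLinearMap.id ℝ E)) y :=
      ((hχ.differentiable (by simp)) (-y)).hasFDerivAt.comp y (hasFDerivAt_id y).neg
    rw [h1.fderiv]
    simp
  have hχL : MemLp χ 2 volume := hχ.continuous.memLp_of_hasCompactSupport hχc
  set L := ContinuousLinearMap.mul ℝ ℝ
  set Φ : ℝ → ℝ := fun s => convolution U χ' L volume (s • h) with hΦ
  have hder : ∀ s : ℝ, HasDerivAt Φ (-∫ z, U z * fderiv ℝ χ (z - s • h) h) s := fun s => by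
    have h1 := hχ'c.hasFDerivAt_convolution_right L hUloc (hχ'd.of_le (by simp)) (s • h)
    have h2 : HasDerivAt (fun s : ℝ => s • h) h s := by
      simpa using (hasDerivAt_id s).smul_const h
    refine (h1.comp_hasDerivAt s h2).congr_deriv ?_
    rw [convolution_precompR_apply L hUloc (hχ'c.fderiv ℝ)
      (hχ'd.continuous_fderiv (by simp)), convolution_def, ← integral_neg]
    refine integral_congr_ae (Filter.Eventually.of_forall fun z => ?_)
    simp only [L, ContinuousLinearMap.mul_apply', hχ'f, neg_sub, mul_neg]
  have hbound : ∀ s ∈ Set.Ico (0 : ℝ) 1, ‖-∫ z, U z * fderiv ℝ χ (z - s • h) h‖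
      ≤ ‖h‖ * (eLpNorm g 2 volume).toReal * (eLpNorm χ 2 volume).toReal := by
    intro s hs
    set χs : E → ℝ := fun z => χ (z - s • h) with hχs'
    have hd : ContDiff ℝ ∞ χs := hχ.comp (contDiff_id.sub contDiff_const)
    have hc : HasCompactSupport χs := hχc.comp_homeomorph (Homeomorph.subRight (s • h))
    have hs : tsupport χs ⊆ Ω := by
      intro z hz
      have h1 : z - s • h ∈ tsupport χ := by
        have := tsupport_comp_subset_preimage χ (f := fun z => z - s • h) (by fun_prop) hz
        exact this
      have h2 := hχs h1 s ⟨hs.1, hs.2.le⟩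
      simpa using h2
    have h1 := hU.integral_eq χs hd hc hs h
    have h2 : ∀ z, fderiv ℝ χs z h = fderiv ℝ χ (z - s • h) h := fun z => by
      rw [hχs', fderiv_comp_sub]
    simp only [h2] at h1
    rw [h1, neg_neg, Real.norm_eq_abs]
    have hg : MemLp (fun x => inner ℝ (g x) h) 2 volume := by
      have := (innerSL ℝ h).comp_memLp' hU.memLp_grad
      refine this.ae_eq (Filter.Eventually.of_forall fun x => ?_)
      simp [real_inner_comm]
    refine (abs_integral_mul_le_eLpNorm hg
      (hd.continuous.memLp_of_hasCompactSupport hc)).trans ?_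
    have h3 : eLpNorm χs 2 volume = eLpNorm χ 2 volume :=
      eLpNorm_comp_measurePreserving hχL.1 (measurePreserving_sub_right volume (s • h))
    rw [h3]
    exact mul_le_mul_of_nonneg_right (eLpNorm_inner_const_toReal_le hU.memLp_grad h)
      ENNReal.toReal_nonneg
  have hmv := norm_image_sub_le_of_norm_deriv_le_segment_01'
    (fun s _ => (hder s).hasDerivWithinAt) hbound
  refine le_of_eq_of_le ?_ hmv
  rw [Real.norm_eq_abs]
  congr 1
  have hL : MemLp (fun x => U (x + h)) 2 volume :=
    hU.memLp.comp_measurePreserving (measurePreserving_add_right volume h)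
  have h1 : Φ 1 = ∫ x, U (x + h) * χ x := by
    simp only [hΦ, convolution_def, L, ContinuousLinearMap.mul_apply', hχ', neg_sub, one_smul]
    rw [← integral_add_right_eq_self _ h]
    simp only [add_sub_cancel_right]
  have h0 : Φ 0 = ∫ x, U x * χ x := by
    simp [hΦ, convolution_def, L, hχ']
  rw [h1, h0]
  simp only [sub_mul]
  exact integral_sub (hL.integrable_mul hχL) (hU.memLp.integrable_mul hχL)

/-- Duality: the `L²(W)` norm of `w` is controlled by testing against smooth functions with compact
support in the open set `W`. -/
theorem eLpNorm_restrict_le_of_abs_integral_le {W : Set E} (hW : IsOpen W) {w : E → ℝ}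
    (hw : MemLp w 2 volume) {K : ℝ} (hK : 0 ≤ K)
    (h : ∀ χ : E → ℝ, ContDiff ℝ ∞ χ → HasCompactSupport χ → tsupport χ ⊆ W →
      |∫ x, w x * χ x| ≤ K * (eLpNorm χ 2 volume).toReal) :
    eLpNorm w 2 (volume.restrict W) ≤ ENNReal.ofReal K := by
  set μ := (volume : Measure E).restrict W
  let S : Submodule ℝ (Lp ℝ 2 μ) :=
    { carrier := {f | ∃ χ : E → ℝ, ContDiff ℝ ∞ χ ∧ HasCompactSupport χ ∧ tsupport χ ⊆ W ∧
        f =ᵐ[μ] χ}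
      zero_mem' := ⟨fun _ => 0, contDiff_const, HasCompactSupport.zero, by
        simp [tsupport], Lp.coeFn_zero _ _ _⟩
      add_mem' := by
        rintro f₁ f₂ ⟨χ₁, h1, h2, h3, h4⟩ ⟨χ₂, k1, k2, k3, k4⟩
        refine ⟨χ₁ + χ₂, h1.add k1, h2.add k2,
          (tsupport_add χ₁ χ₂).trans (Set.union_subset h3 k3), ?_⟩
        exact (Lp.coeFn_add f₁ f₂).trans (h4.add k4)
      smul_mem' := by
        rintro c f ⟨χ, h1, h2, h3, h4⟩
        refine ⟨c • χ, h1.const_smul c, h2.smul_left (f := fun _ => c),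
          (tsupport_smul_subset_right (fun _ => c) χ).trans h3, ?_⟩
        exact (Lp.coeFn_smul c f).trans (h4.const_smul c) }
  have hout : ∀ {χ : E → ℝ}, tsupport χ ⊆ W → ∀ x, x ∉ W → χ x = 0 := fun hs x hx =>
    image_eq_zero_of_notMem_tsupport fun h' => hx (hs h')
  have hSperp : Sᗮ = ⊥ := by
    rw [eq_bot_iff]
    intro f hf
    rw [Submodule.mem_bot]
    have hloc : LocallyIntegrableOn f W volume :=
      locallyIntegrableOn_of_locallyIntegrable_restrict
        ((Lp.memLp f).locallyIntegrable one_le_two)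
    have h0 := hW.ae_eq_zero_of_integral_contDiff_smul_eq_zero hloc (fun χ h1 h2 h3 => by
      have hχL : MemLp χ 2 μ := (h1.continuous.memLp_of_hasCompactSupport h2).restrict W
      have h4 := hf (hχL.toLp χ) ⟨χ, h1, h2, h3, hχL.coeFn_toLp⟩
      rw [L2.inner_def] at h4
      rw [← setIntegral_eq_integral_of_forall_compl_eq_zero (s := W)
        (fun x hx => by rw [hout h3 x hx, zero_smul]), ← h4]
      refine integral_congr_ae ?_
      filter_upwards [hχL.coeFn_toLp] with x hx
      rw [hx]
      simp [mul_comm])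
    rw [Lp.eq_zero_iff_ae_eq_zero]
    exact (ae_restrict_iff' hW.measurableSet).2 h0
  have hdense : Dense (S : Set (Lp ℝ 2 μ)) := by
    rw [← Submodule.topologicalClosure_eq_top_iff] at hSperp
    exact Submodule.dense_iff_topologicalClosure_eq_top.2 hSperp
  have hwμ : MemLp w 2 μ := hw.restrict W
  have hall : ∀ f : Lp ℝ 2 μ, |inner ℝ (hwμ.toLp w) f| ≤ K * ‖f‖ := by
    intro f
    refine hdense.induction (P := fun f => |inner ℝ (hwμ.toLp w) f| ≤ K * ‖f‖) ?_ ?_ f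
    · rintro f ⟨χ, h1, h2, h3, h4⟩
      have h5 : eLpNorm χ 2 volume = eLpNorm f 2 μ := by
        rw [eLpNorm_congr_ae h4, eLpNorm_restrict_eq_of_support_subset]
        exact (subset_tsupport χ).trans h3
      rw [Lp.norm_def, ← h5]
      refine le_of_eq_of_le ?_ (h χ h1 h2 h3)
      rw [L2.inner_def, ← setIntegral_eq_integral_of_forall_compl_eq_zero (s := W)
        (f := fun x => w x * χ x) (fun x hx => by rw [hout h3 x hx, mul_zero])]
      congr 1
      refine integral_congr_ae ?_
      filter_upwards [hwμ.coeFn_toLp, h4] with x hx hx'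
      rw [hx, hx']
      simp [mul_comm]
    · exact isClosed_le (by fun_prop) (by fun_prop)
  have h1 := hall (hwμ.toLp w)
  rw [real_inner_self_eq_norm_sq, abs_of_nonneg (sq_nonneg _)] at h1
  have h2 : ‖hwμ.toLp w‖ ≤ K := by
    by_contra hlt
    push Not at hlt
    nlinarith [norm_nonneg (hwμ.toLp w)]
  rw [Lp.norm_toLp] at h2
  exact (ENNReal.le_ofReal_iff_toReal_le hwμ.eLpNorm_ne_top hK).2 h2

/-- Translation estimate: `‖U(· + h) - U‖ ≤ ‖h‖ ‖∇U‖` in `L²` of the points whose segment to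
`x + h` stays in `Ω`. -/
theorem IsWeakGradientOn.lintegral_translate_le {Ω : Set E} (hΩ : IsOpen Ω) {U : E → ℝ} {g : E → E}
    (hU : IsWeakGradientOn Ω U g) (h : E) :
    ∫⁻ x in segmentCore Ω h, ‖U (x + h) - U x‖ₑ ^ 2 ≤ ‖h‖ₑ ^ 2 * eLpNorm g 2 volume ^ 2 := by
  have hL : MemLp (fun x => U (x + h)) 2 volume :=
    hU.memLp.comp_measurePreserving (measurePreserving_add_right volume h)
  have h1 := eLpNorm_restrict_le_of_abs_integral_le (isOpen_segmentCore hΩ h)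
    (hL.sub hU.memLp) (K := ‖h‖ * (eLpNorm g 2 volume).toReal) (by positivity)
    (fun χ h1 h2 h3 => hU.abs_integral_translate_le h h1 h2 h3)
  have h2 := eLpNorm_nnreal_pow_eq_lintegral (p := 2) (f := (fun x => U (x + h)) - U)
    (μ := volume.restrict (segmentCore Ω h)) (by norm_num)
  rw [ENNReal.ofReal_mul (norm_nonneg h), ENNReal.ofReal_toReal hU.memLp_grad.eLpNorm_ne_top,
    ofReal_norm] at h1
  have h3 := pow_le_pow_left' h1 2
  rw [mul_pow] at h3
  refine le_of_eq_of_le ?_ h3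
  norm_num at h2
  exact_mod_cast h2.symm

end Translation

/-! ### Mutual oscillation of subsets of a domain -/

section Oscillation

open scoped ENNReal Topology

variable {E : Type*} [NormedAddCommGroup E] [InnerProductSpace ℝ E] [FiniteDimensional ℝ E]
  [MeasurableSpace E] [BorelSpace E]

/-- The mutual oscillation `∫_A ∫_B |U(x) - U(y)|² dy dx`. -/
noncomputable def l2Oscillation (U : E → ℝ) (A B : Set E) : ℝ≥0∞ :=
  ∫⁻ x in A, ∫⁻ y in B, ‖U x - U y‖ₑ ^ 2

/-- The mutual oscillation between `A` and `B` of every weakly differentiable function on `Ω` is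
bounded by a multiple of `‖∇U‖²`. -/
def OscillationBound (Ω A B : Set E) : Prop :=
  ∃ C : ℝ≥0∞, C ≠ ⊤ ∧ ∀ (U : E → ℝ) (g : E → E), IsWeakGradientOn Ω U g →
    l2Oscillation U A B ≤ C * eLpNorm g 2 volume ^ 2

omit [NormedAddCommGroup E] [InnerProductSpace ℝ E] [FiniteDimensional ℝ E] [BorelSpace E] in
theorem measurable_enorm_sub_sq {U : E → ℝ} (hU : Measurable U) :
    Measurable fun p : E × E => ‖U p.1 - U p.2‖ₑ ^ 2 :=
  (((hU.comp measurable_fst).sub (hU.comp measurable_snd)).enorm).pow_const 2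

theorem l2Oscillation_comm {U : E → ℝ} (hU : Measurable U) (A B : Set E) :
    l2Oscillation U A B = l2Oscillation U B A := by
  unfold l2Oscillation
  rw [lintegral_lintegral_swap (measurable_enorm_sub_sq hU).aemeasurable]
  simp only [enorm_sub_rev]

theorem OscillationBound.symm {Ω A B : Set E} (h : OscillationBound Ω A B) :
    OscillationBound Ω B A := by
  obtain ⟨C, hC, h⟩ := h
  refine ⟨C, hC, fun U g hU => ?_⟩
  rw [l2Oscillation_comm hU.measurable]
  exact h U g hU

theorem OscillationBound.mono {Ω A B A' B' : Set E}
    (h : OscillationBound Ω A B) (hA : A' ⊆ A) (hB : B' ⊆ B) : OscillationBound Ω A' B' := by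
  obtain ⟨C, hC, h⟩ := h
  refine ⟨C, hC, fun U g hU => le_trans ?_ (h U g hU)⟩
  exact lintegral_mono' (Measure.restrict_mono_set _ hA)
    (fun x => lintegral_mono_set hB)

/-- Oscillation bounds compose along an intermediate set of positive measure. -/
theorem OscillationBound.trans {Ω A B C : Set E} (hA : volume A ≠ ⊤) (hC : volume C ≠ ⊤)
    (hB : volume B ≠ 0) (hB' : volume B ≠ ⊤)
    (h₁ : OscillationBound Ω A B) (h₂ : OscillationBound Ω B C) : OscillationBound Ω A C := by
  obtain ⟨C₁, hC₁, h₁⟩ := h₁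
  obtain ⟨C₂, hC₂, h₂⟩ := h₂
  refine ⟨2 * (volume C * C₁ + volume A * C₂) / volume B, ENNReal.div_ne_top (by finiteness) hB,
    fun U g hU => ?_⟩
  have hm := measurable_enorm_sub_sq hU.measurable
  have hpt : ∀ x z y : E, ‖U x - U z‖ₑ ^ 2 ≤ 2 * ‖U x - U y‖ₑ ^ 2 + 2 * ‖U y - U z‖ₑ ^ 2 := by
    intro x z y
    have h1 : ‖U x - U z‖ₑ ≤ ‖U x - U y‖ₑ + ‖U y - U z‖ₑ := by
      rw [show U x - U z = (U x - U y) + (U y - U z) by ring]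
      exact enorm_add_le _ _
    refine (pow_le_pow_left' h1 2).trans ?_
    have h2 := ENNReal.rpow_add_le_mul_rpow_add_rpow ‖U x - U y‖ₑ ‖U y - U z‖ₑ (p := 2) one_le_two
    rw [← mul_add]
    have h3 : (2 : ℝ≥0∞) ^ ((2 : ℝ) - 1) = 2 := by norm_num
    rw [h3] at h2
    exact_mod_cast h2
  have hUm := hU.measurable
  have key : l2Oscillation U A C * volume B
      ≤ 2 * (volume C * l2Oscillation U A B) + 2 * (volume A * l2Oscillation U B C) := by
    have e1 : l2Oscillation U A C * volume B
        = ∫⁻ x in A, ∫⁻ z in C, ∫⁻ _ in B, ‖U x - U z‖ₑ ^ 2 := by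
      simp only [lintegral_const, Measure.restrict_apply_univ]
      unfold l2Oscillation
      rw [← lintegral_mul_const _ hm.lintegral_prod_right']
      refine lintegral_congr fun x => ?_
      rw [← lintegral_mul_const _ (by fun_prop)]
    have e2 : ∫⁻ x in A, ∫⁻ z in C, ∫⁻ y in B,
          (2 * ‖U x - U y‖ₑ ^ 2 + 2 * ‖U y - U z‖ₑ ^ 2)
        = 2 * (volume C * l2Oscillation U A B) + 2 * (volume A * l2Oscillation U B C) := by
      have e3 : ∀ x z, ∫⁻ y in B, (2 * ‖U x - U y‖ₑ ^ 2 + 2 * ‖U y - U z‖ₑ ^ 2)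
          = 2 * (∫⁻ y in B, ‖U x - U y‖ₑ ^ 2) + 2 * ∫⁻ y in B, ‖U y - U z‖ₑ ^ 2 := by
        intro x z
        rw [lintegral_add_left (by fun_prop), lintegral_const_mul _ (by fun_prop),
          lintegral_const_mul _ (by fun_prop)]
      have hm2 : Measurable fun z => ∫⁻ y in B, ‖U y - U z‖ₑ ^ 2 := hm.lintegral_prod_left'
      have hm3 : Measurable fun x => ∫⁻ y in B, ‖U x - U y‖ₑ ^ 2 := hm.lintegral_prod_right'
      have e4 : ∫⁻ z in C, ∫⁻ y in B, ‖U y - U z‖ₑ ^ 2 = l2Oscillation U B C := by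
        unfold l2Oscillation
        exact lintegral_lintegral_swap
          (hm.comp measurable_swap).aemeasurable
      simp only [e3]
      have e5 : ∀ x, ∫⁻ z in C, (2 * (∫⁻ y in B, ‖U x - U y‖ₑ ^ 2)
            + 2 * ∫⁻ y in B, ‖U y - U z‖ₑ ^ 2)
          = 2 * volume C * (∫⁻ y in B, ‖U x - U y‖ₑ ^ 2) + 2 * l2Oscillation U B C := by
        intro x
        rw [lintegral_add_left measurable_const, lintegral_const_mul _ hm2, e4, lintegral_const,
          Measure.restrict_apply_univ]
        ring
      simp only [e5]
      rw [lintegral_add_right _ measurable_const, lintegral_const_mul _ hm3, lintegral_const,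
        Measure.restrict_apply_univ]
      unfold l2Oscillation
      ring
    rw [e1, ← e2]
    exact lintegral_mono fun x => lintegral_mono fun z => lintegral_mono fun y => hpt x z y
  rw [ENNReal.mul_comm_div, ← mul_div_assoc, ENNReal.le_div_iff_mul_le (Or.inl hB) (Or.inl hB')]
  refine key.trans ?_
  calc 2 * (volume C * l2Oscillation U A B) + 2 * (volume A * l2Oscillation U B C)
      ≤ 2 * (volume C * (C₁ * eLpNorm g 2 volume ^ 2))
        + 2 * (volume A * (C₂ * eLpNorm g 2 volume ^ 2)) := by
        gcongr
        · exact h₁ U g hU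
        · exact h₂ U g hU
    _ = _ := by ring

theorem OscillationBound.biUnion_left {ι : Type*} {Ω B : Set E} (t : Finset ι) {A : ι → Set E}
    (h : ∀ i ∈ t, OscillationBound Ω (A i) B) : OscillationBound Ω (⋃ i ∈ t, A i) B := by
  choose! C hC h using h
  refine ⟨∑ i ∈ t, C i, ENNReal.sum_ne_top.2 hC, fun U g hU => ?_⟩
  rw [Finset.sum_mul]
  have h1 : l2Oscillation U (⋃ i ∈ t, A i) B ≤ ∑ i ∈ t, l2Oscillation U (A i) B := by
    classical
    unfold l2Oscillation
    induction t using Finset.induction_on with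
    | empty => simp
    | insert i t hi ih =>
      rw [Finset.set_biUnion_insert, Finset.sum_insert hi]
      exact (lintegral_union_le _ _ _).trans (add_le_add_right
        (ih (fun i hi => hC i (Finset.mem_insert_of_mem hi))
          (fun i hi => h i (Finset.mem_insert_of_mem hi))) _)
  exact h1.trans (Finset.sum_le_sum fun i hi => h i hi U g hU)

/-- If all segments from `A` to `B` lie in `Ω`, then the mutual oscillation of `A` and `B` is
controlled: integrate the translation estimate over all translations. -/
theorem oscillationBound_of_segments {Ω A B : Set E} (hΩ : IsOpen Ω) (hA : MeasurableSet A)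
    (hB : MeasurableSet B) {D : ℝ} (hD : ∀ x ∈ A, ∀ y ∈ B, ‖y - x‖ ≤ D)
    (hseg : ∀ x ∈ A, ∀ y ∈ B, ∀ s ∈ Set.Icc (0 : ℝ) 1, x + s • (y - x) ∈ Ω) :
    OscillationBound Ω A B := by
  refine ⟨ENNReal.ofReal D ^ 2 * volume (Metric.closedBall (0 : E) D), ?_, fun U g hU => ?_⟩
  · exact ENNReal.mul_ne_top (by finiteness)
      (measure_closedBall_lt_top (μ := (volume : Measure E))).ne
  have hUm := hU.measurable
  set F : E → E → ℝ≥0∞ := fun x y =>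
    A.indicator 1 x * (B.indicator 1 y * ‖U x - U y‖ₑ ^ 2) with hF
  have hAm : Measurable (A.indicator (1 : E → ℝ≥0∞)) := measurable_one.indicator hA
  have hBm : Measurable (B.indicator (1 : E → ℝ≥0∞)) := measurable_one.indicator hB
  have hFm : Measurable (Function.uncurry fun x h => F x (x + h)) := by
    simp only [hF, Function.uncurry_def]
    fun_prop
  have e1 : l2Oscillation U A B = ∫⁻ x, ∫⁻ h, F x (x + h) := by
    unfold l2Oscillation
    rw [← lintegral_indicator hA]
    refine lintegral_congr fun x => ?_
    rw [lintegral_add_left_eq_self (fun y => F x y) x]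
    by_cases hx : x ∈ A
    · simp only [hF, Set.indicator_of_mem hx, Pi.one_apply, one_mul]
      rw [← lintegral_indicator hB]
      refine lintegral_congr fun y => ?_
      by_cases hy : y ∈ B <;> simp [hy]
    · simp [hF, hx]
  rw [e1, lintegral_lintegral_swap hFm.aemeasurable]
  have hpt : ∀ h : E, ∫⁻ x, F x (x + h)
      ≤ (Metric.closedBall (0 : E) D).indicator
          (fun _ => ENNReal.ofReal D ^ 2 * eLpNorm g 2 volume ^ 2) h := by
    intro h
    by_cases hh : ‖h‖ ≤ D
    · rw [Set.indicator_of_mem (by simpa using hh)]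
      have h1 : ‖h‖ₑ ≤ ENNReal.ofReal D := by
        rw [← ofReal_norm]; exact ENNReal.ofReal_le_ofReal hh
      refine le_trans ?_ ((hU.lintegral_translate_le hΩ h).trans
        (mul_le_mul_left (pow_le_pow_left' h1 2) _))
      rw [← lintegral_indicator (isOpen_segmentCore hΩ h).measurableSet]
      refine lintegral_mono fun x => ?_
      by_cases hx : x ∈ A
      · by_cases hy : x + h ∈ B
        · have hc : x ∈ segmentCore Ω h := fun s hs => by
            simpa using hseg x hx (x + h) hy s hs
          simp [hF, hx, hy, hc, enorm_sub_rev]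
        · simp [hF, hy]
      · simp [hF, hx]
    · have h0 : ∀ x, F x (x + h) = 0 := fun x => by
        by_cases hx : x ∈ A
        · by_cases hy : x + h ∈ B
          · exact absurd (by simpa using hD x hx (x + h) hy) hh
          · simp [hF, hy]
        · simp [hF, hx]
      simp [h0]
  refine (lintegral_mono hpt).trans ?_
  rw [lintegral_indicator measurableSet_closedBall, lintegral_const, Measure.restrict_apply_univ]
  exact le_of_eq (by ring)

/-- The points from which every point of `K` is visible inside `Ω`. -/
def visibleFrom (Ω K : Set E) : Set E :=
  {x | ∀ y ∈ K, ∀ s ∈ Set.Icc (0 : ℝ) 1, x + s • (y - x) ∈ Ω}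

omit [FiniteDimensional ℝ E] [MeasurableSpace E] [BorelSpace E] in
theorem isOpen_visibleFrom {Ω K : Set E} (hΩ : IsOpen Ω) (hK : IsCompact K) :
    IsOpen (visibleFrom Ω K) := by
  rw [isOpen_iff_eventually]
  intro x hx
  have h : ∀ᶠ x' in 𝓝 x, ∀ p ∈ K ×ˢ Set.Icc (0 : ℝ) 1, x' + p.2 • (p.1 - x') ∈ Ω := by
    refine (hK.prod isCompact_Icc).eventually_forall_of_forall_eventually fun p hp => ?_
    have hc : Continuous fun q : E × (E × ℝ) => q.1 + q.2.2 • (q.2.1 - q.1) := by fun_prop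
    exact hc.continuousAt.eventually (hΩ.mem_nhds (hx p.1 hp.1 p.2 hp.2))
  filter_upwards [h] with x' hx' y hy s hs using hx' (y, s) ⟨hy, hs⟩

theorem oscillationBound_of_convex {Ω A : Set E} (hΩ : IsOpen Ω) (hA : MeasurableSet A)
    (hb : Bornology.IsBounded A) (hc : Convex ℝ A) (hAΩ : A ⊆ Ω) : OscillationBound Ω A A := by
  obtain ⟨D, hD⟩ := Metric.isBounded_iff.1 hb
  refine oscillationBound_of_segments hΩ hA hA (D := D)
    (fun x hx y hy => by rw [← dist_eq_norm]; exact hD hy hx) fun x hx y hy s hs => ?_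
  exact hAΩ (hc.add_smul_sub_mem hx hy hs)

/-- In a connected open set, any two points have neighbourhoods of controlled mutual oscillation. -/
theorem exists_oscillationBound_balls {Ω : Set E} (hΩ : IsOpen Ω) (hconn : IsPreconnected Ω)
    {x y : E} (hx : x ∈ Ω) (hy : y ∈ Ω) :
    ∃ r > 0, OscillationBound Ω (Metric.ball x r) (Metric.ball y r) := by
  refine hconn.induction₂
    (fun x y => ∃ r > 0, OscillationBound Ω (Metric.ball x r) (Metric.ball y r)) ?_ ?_ ?_ hx hy
  · intro x hx
    obtain ⟨r, hr, hball⟩ := Metric.isOpen_iff.1 hΩ x hx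
    have hb := oscillationBound_of_convex hΩ measurableSet_ball Metric.isBounded_ball
      (convex_ball x r) hball
    filter_upwards [mem_nhdsWithin_of_mem_nhds (Metric.ball_mem_nhds x (half_pos hr))] with y hy
    refine ⟨r / 2, half_pos hr, hb.mono (Metric.ball_subset_ball (by linarith))
      (Metric.ball_subset_ball' ?_)⟩
    linarith [Metric.mem_ball.1 hy]
  · rintro x y z - - - ⟨r₁, hr₁, h₁⟩ ⟨r₂, hr₂, h₂⟩
    have hr : 0 < min r₁ r₂ := lt_min hr₁ hr₂
    refine ⟨min r₁ r₂, hr, OscillationBound.trans (B := Metric.ball y (min r₁ r₂))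
      measure_ball_lt_top.ne measure_ball_lt_top.ne (Metric.measure_ball_pos _ _ hr).ne'
      measure_ball_lt_top.ne (h₁.mono ?_ ?_) (h₂.mono ?_ ?_)⟩ <;>
    exact Metric.ball_subset_ball (by simp)
  · rintro x y - - ⟨r, hr, h⟩
    exact ⟨r, hr, h.symm⟩

/-- If every point of the bounded connected open set `Ω` sees, inside `Ω`, a ball of a fixed radius,
then the oscillation over all of `Ω` is controlled: finitely many balls serve all points, and any
two balls are linked through `Ω`. -/
theorem oscillationBound_of_visible_balls {Ω : Set E} (hΩ : IsOpen Ω) (hconn : IsPreconnected Ω)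
    (hb : Bornology.IsBounded Ω) {ρ : ℝ} (hρ : 0 < ρ)
    (hvis : ∀ x ∈ Ω, ∃ z ∈ Ω, x ∈ visibleFrom Ω (Metric.closedBall z (2 * ρ))) :
    OscillationBound Ω Ω Ω := by
  obtain ⟨t, htΩ, htfin, hcover⟩ := Metric.finite_approx_of_totallyBounded
    (hb.isCompact_closure.totallyBounded.subset subset_closure) ρ hρ
  have hΩfin : volume Ω ≠ ⊤ := hb.measure_lt_top.ne
  lift t to Finset E using htfin
  set A : E → Set E := fun z => visibleFrom Ω (Metric.closedBall z ρ) ∩ Ω with hA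
  have hcov : Ω ⊆ ⋃ z ∈ t, A z := by
    intro x hx
    obtain ⟨z, hz, hxz⟩ := hvis x hx
    obtain ⟨z', hz', hzz'⟩ := Set.mem_iUnion₂.1 (hcover hz)
    refine Set.mem_iUnion₂.2 ⟨z', by simpa using hz', ?_, hx⟩
    intro y hy s hs
    refine hxz y ?_ s hs
    refine Metric.closedBall_subset_closedBall' ?_ hy
    have := Metric.mem_ball.1 hzz'
    rw [dist_comm] at this
    linarith
  -- each piece is linked to every small ball around a point of `Ω`
  have hlink : ∀ z ∈ t, ∀ w ∈ Ω, ∃ r > 0, OscillationBound Ω (A z) (Metric.ball w r) := by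
    intro z hz w hw
    have hzΩ : z ∈ Ω := htΩ hz
    obtain ⟨D, hD⟩ := Metric.isBounded_iff.1 (hb.union (Metric.isBounded_closedBall (x := z)
      (r := ρ)))
    have h1 : OscillationBound Ω (A z) (Metric.closedBall z ρ) := by
      refine oscillationBound_of_segments hΩ
        ((isOpen_visibleFrom hΩ (isCompact_closedBall z ρ)).inter hΩ).measurableSet
        measurableSet_closedBall (D := D) (fun x hx y hy => ?_) fun x hx y hy s hs =>
          hx.1 y hy s hs
      rw [← dist_eq_norm]
      exact hD (Or.inr hy) (Or.inl hx.2)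
    obtain ⟨r, hr, h2⟩ := exists_oscillationBound_balls hΩ hconn hzΩ hw
    have hr' : 0 < min r ρ := lt_min hr hρ
    refine ⟨r, hr, OscillationBound.trans (B := Metric.ball z (min r ρ))
      ((measure_mono Set.inter_subset_right).trans_lt hb.measure_lt_top).ne
      measure_ball_lt_top.ne (Metric.measure_ball_pos _ _ hr').ne' measure_ball_lt_top.ne
      (h1.mono le_rfl ?_) (h2.mono (Metric.ball_subset_ball (min_le_left _ _)) le_rfl)⟩
    exact (Metric.ball_subset_ball (min_le_right _ _)).trans Metric.ball_subset_closedBall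
  rcases Ω.eq_empty_or_nonempty with rfl | ⟨w, hw⟩
  · exact ⟨0, by simp, fun U g _ => by simp [l2Oscillation]⟩
  choose! r hr hbd using fun z hz => hlink z hz w hw
  -- a radius that works for all pieces at once
  obtain ⟨r₀, hr₀, hle⟩ : ∃ r₀ > 0, ∀ z ∈ t, r₀ ≤ r z := by
    rcases t.eq_empty_or_nonempty with rfl | hne
    · exact ⟨1, one_pos, by simp⟩
    · obtain ⟨z₀, hz₀, hmin⟩ := t.exists_min_image r hne
      exact ⟨r z₀, hr z₀ hz₀, hmin⟩
  have hall : OscillationBound Ω Ω (Metric.ball w r₀) :=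
    (OscillationBound.biUnion_left t (A := A) fun z hz =>
      (hbd z hz).mono le_rfl (Metric.ball_subset_ball (hle z hz))).mono hcov le_rfl
  exact OscillationBound.trans hΩfin hΩfin (Metric.measure_ball_pos _ _ hr₀).ne'
    measure_ball_lt_top.ne hall hall.symm

end Oscillation

/-! ### The Poincaré inequality on the two kinds of domains -/

section Domain

open scoped ENNReal Topology

variable {d : ℕ}

theorem Geometry.domain_periodic_eq (ℓ : Fin d → ℝ) (hℓ : ∀ i, 0 < ℓ i) :
    (Geometry.periodic ℓ hℓ).domain
      = WithLp.ofLp ⁻¹' (Set.pi Set.univ fun i => Set.Ioo (0 : ℝ) (ℓ i)) := by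
  ext x
  simp [Geometry.domain]

theorem Geometry.isOpen_domain (G : Geometry d) : IsOpen G.domain := by
  cases G with
  | neumann Ω hΩ _ _ _ => exact hΩ
  | periodic ℓ hℓ =>
    rw [Geometry.domain_periodic_eq]
    exact (isOpen_set_pi Set.finite_univ fun i _ => isOpen_Ioo).preimage
      (PiLp.continuous_ofLp 2 _)

theorem Geometry.nonempty_domain (G : Geometry d) : G.domain.Nonempty := by
  cases G with
  | neumann Ω _ hconn _ _ => exact hconn.nonempty
  | periodic ℓ hℓ =>
    exact ⟨WithLp.toLp 2 fun i => ℓ i / 2, fun i => ⟨half_pos (hℓ i), half_lt_self (hℓ i)⟩⟩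

theorem Geometry.volume_domain_ne_zero (G : Geometry d) : volume G.domain ≠ 0 :=
  (G.isOpen_domain.measure_pos volume G.nonempty_domain).ne'

theorem Geometry.volume_domain_ne_top (G : Geometry d) : volume G.domain ≠ ⊤ :=
  G.isBounded_domain.measure_lt_top.ne

/-- A domain satisfying the cone condition contains, in the cone at each of its points, a ball of
fixed radius which is visible from the vertex. -/
theorem ConeCondition.exists_visible_ball {Ω : Set (Space d)} (hcone : ConeCondition Ω) :
    ∃ ρ > 0, ∀ x ∈ Ω, ∃ z ∈ Ω, x ∈ visibleFrom Ω (Metric.closedBall z (2 * ρ)) := by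
  obtain ⟨h, c, hh, hc, hc1, hx⟩ := hcone
  -- the cone contains the ball of radius `h (1 - c) / 4` about the point at height `h / 2`
  refine ⟨h * (1 - c) / 8, by have := sub_pos.2 hc1; positivity, fun x hxΩ => ?_⟩
  obtain ⟨e, he, hcone⟩ := hx x hxΩ
  have hee : inner ℝ e e = (1 : ℝ) := by rw [real_inner_self_eq_norm_sq, he, one_pow]
  have hseg : ∀ y ∈ Metric.closedBall (x + (h / 2) • e) (2 * (h * (1 - c) / 8)),
      ∀ s ∈ Set.Icc (0 : ℝ) 1, x + s • (y - x) ∈ Ω := by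
    intro y hy s hs
    set v := y - (x + (h / 2) • e) with hv
    have hvn : ‖v‖ ≤ h * (1 - c) / 4 := by
      rw [Metric.mem_closedBall, dist_eq_norm] at hy
      linarith
    have hyx : y - x = (h / 2) • e + v := by rw [hv]; abel
    have hn : ‖y - x‖ ≤ h / 2 + h * (1 - c) / 4 := by
      rw [hyx]
      refine (norm_add_le _ _).trans ?_
      rw [norm_smul, he, mul_one, Real.norm_of_nonneg (by linarith)]
      linarith
    have hi : h / 2 - h * (1 - c) / 4 ≤ inner ℝ (y - x) e := by
      rw [hyx, inner_add_left, real_inner_smul_left, hee]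
      have h1 := abs_real_inner_le_norm v e
      rw [he, mul_one] at h1
      have h2 := neg_abs_le (inner ℝ v e)
      linarith
    have hnn := norm_nonneg (y - x)
    have hci : c * ‖y - x‖ ≤ inner ℝ (y - x) e := by
      refine le_trans ?_ hi
      have h1 : c * ‖y - x‖ ≤ c * (h / 2 + h * (1 - c) / 4) := mul_le_mul_of_nonneg_left hn hc.le
      have h2 : 0 ≤ h * (1 - c) * (1 - c) :=
        mul_nonneg (mul_nonneg hh.le (sub_nonneg.2 hc1.le)) (sub_nonneg.2 hc1.le)
      nlinarith
    refine hcone _ ?_ ?_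
    · rw [norm_smul, Real.norm_of_nonneg hs.1]
      have h1 : s * ‖y - x‖ ≤ ‖y - x‖ := mul_le_of_le_one_left hnn hs.2
      have h2 : 0 < h * c := mul_pos hh hc
      linarith
    · rw [norm_smul, Real.norm_of_nonneg hs.1, real_inner_smul_left]
      have := mul_le_mul_of_nonneg_left hci hs.1
      linarith
  refine ⟨x + (h / 2) • e, ?_, fun y hy s hs => hseg y hy s hs⟩
  have h0 : 0 ≤ 2 * (h * (1 - c) / 8) := by
    have := mul_nonneg hh.le (sub_nonneg.2 hc1.le)
    linarith
  simpa using hseg _ (Metric.mem_closedBall_self h0) 1 ⟨zero_le_one, le_rfl⟩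

theorem Geometry.oscillationBound (G : Geometry d) :
    OscillationBound G.domain G.domain G.domain := by
  have hopen := G.isOpen_domain
  have hb := G.isBounded_domain
  cases G with
  | neumann Ω _ hconn _ hcone =>
    obtain ⟨ρ, hρ, hvis⟩ := hcone.exists_visible_ball
    exact oscillationBound_of_visible_balls hopen hconn.isPreconnected hb hρ hvis
  | periodic ℓ hℓ =>
    refine oscillationBound_of_convex hopen hopen.measurableSet hb ?_ le_rfl
    rw [Geometry.domain_periodic_eq]
    exact (convex_pi fun i _ => convex_Ioo 0 (ℓ i)).linear_preimage
      (WithLp.linearEquiv 2 ℝ (Fin d → ℝ)).toLinearMap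

/-- The lattice vector with coordinates `k i * ℓ i`. -/
noncomputable def latticeVector (ℓ : Fin d → ℝ) (k : Fin d → ℤ) : Space d :=
  WithLp.toLp 2 fun i => k i * ℓ i

/-- A smooth function with compact support extends periodically: the sum of its translates by the
lattice of periods. -/
theorem contDiff_finsum_lattice {ℓ : Fin d → ℝ} (hℓ : ∀ i, 0 < ℓ i) {χ : Space d → ℝ}
    (hχ : ContDiff ℝ ∞ χ) (hχc : HasCompactSupport χ) :
    ContDiff ℝ ∞ fun x => ∑ᶠ k : Fin d → ℤ, χ (x + latticeVector ℓ k) := by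
  rw [← contMDiff_iff_contDiff]
  refine contMDiff_finsum (fun k => ?_) fun x => ?_
  · rw [contMDiff_iff_contDiff]
    exact hχ.comp (contDiff_id.add contDiff_const)
  · obtain ⟨R, hR⟩ := hχc.isCompact.isBounded.exists_norm_le
    refine ⟨Metric.ball x 1, Metric.ball_mem_nhds x one_pos, ?_⟩
    refine (Set.finite_Icc (fun i => -⌈(R + ‖x‖ + 1) / ℓ i⌉)
      (fun i => ⌈(R + ‖x‖ + 1) / ℓ i⌉)).subset ?_
    rintro k ⟨y, hy, hyx⟩
    have h1 : ‖y + latticeVector ℓ k‖ ≤ R := hR _ (subset_tsupport χ hy)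
    have h2 : ‖y‖ ≤ ‖x‖ + 1 := by
      have := norm_sub_norm_le y x
      rw [Metric.mem_ball, dist_eq_norm] at hyx
      linarith
    have h3 : ‖latticeVector ℓ k‖ ≤ R + ‖x‖ + 1 := by
      have := norm_sub_le (y + latticeVector ℓ k) y
      rw [add_sub_cancel_left] at this
      linarith
    have h4 : ∀ i, |(k i : ℝ)| ≤ (R + ‖x‖ + 1) / ℓ i := fun i => by
      rw [le_div_iff₀ (hℓ i)]
      have h5 := (PiLp.norm_apply_le (latticeVector ℓ k) i).trans h3
      simpa [latticeVector, abs_mul, abs_of_pos (hℓ i)] using h5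
    have h6 : ∀ i, |k i| ≤ ⌈(R + ‖x‖ + 1) / ℓ i⌉ := fun i => by
      have := (h4 i).trans (Int.le_ceil _)
      exact_mod_cast this
    exact ⟨fun i => (abs_le.1 (h6 i)).1, fun i => (abs_le.1 (h6 i)).2⟩

/-- Smooth functions with compact support in `Ω` agree on `Ω` with a test function of `G`. -/
theorem Geometry.exists_testFunction_eqOn (G : Geometry d) {χ : Space d → ℝ}
    (hχ : ContDiff ℝ ∞ χ) (hχc : HasCompactSupport χ) (hχs : tsupport χ ⊆ G.domain) :
    ∃ χ' ∈ G.testFunctions, Set.EqOn χ' χ G.domain := by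
  cases G with
  | neumann Ω => exact ⟨χ, ⟨hχ, hχc, hχs⟩, fun _ _ => rfl⟩
  | periodic ℓ hℓ =>
    refine ⟨fun x => ∑ᶠ k : Fin d → ℤ, χ (x + latticeVector ℓ k),
      ⟨contDiff_finsum_lattice hℓ hχ hχc, fun i x => ?_⟩, fun x hx => ?_⟩
    · have h1 : ∀ k, x + EuclideanSpace.single i (ℓ i) + latticeVector ℓ k
          = x + latticeVector ℓ ((Equiv.addRight (Pi.single i (1 : ℤ))) k) := by
        intro k
        ext j
        by_cases hj : j = i
        · subst hj
          simp [latticeVector]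
          ring
        · simp [latticeVector, hj]
      simp only [h1]
      exact finsum_comp_equiv (Equiv.addRight (Pi.single i (1 : ℤ)))
        (f := fun k => χ (x + latticeVector ℓ k))
    · change ∑ᶠ k : Fin d → ℤ, χ (x + latticeVector ℓ k) = χ x
      rw [finsum_eq_single _ 0]
      · congr 1
        ext j
        simp [latticeVector]
      · intro k hk
        by_contra hne
        have hy : x + latticeVector ℓ k ∈ (Geometry.periodic ℓ hℓ).domain :=
          hχs (subset_tsupport χ hne)
        refine hk (funext fun i => ?_)
        have h1 := hx i
        have h2 : 0 < x i + k i * ℓ i ∧ x i + k i * ℓ i < ℓ i := hy i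
        have h3 : (k i : ℝ) < 1 := by
          by_contra h
          push Not at h
          nlinarith [hℓ i]
        have h4 : -1 < (k i : ℝ) := by
          by_contra h
          push Not at h
          nlinarith [hℓ i]
        have h5 : k i < 1 := by exact_mod_cast h3
        have h6 : -1 < k i := by exact_mod_cast h4
        simp only [Pi.zero_apply]
        omega

/-- An element of `H¹(Ω)`, extended by zero, is weakly differentiable in `Ω`. -/
theorem isWeakGradientOn_indicator {G : Geometry d} (u : H1 G) :
    IsWeakGradientOn G.domain (G.domain.indicator (fn u)) (G.domain.indicator (wgrad u)) := by
  have hm := G.isOpen_domain.measurableSet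
  refine ⟨((Lp.stronglyMeasurable (fn u)).measurable).indicator hm,
    (memLp_indicator_iff_restrict hm).2 (Lp.memLp _),
    (memLp_indicator_iff_restrict hm).2 (Lp.memLp _), fun χ hχ hχc hχs v => ?_⟩
  obtain ⟨χ', hχ', heq⟩ := G.exists_testFunction_eqOn hχ hχc hχs
  have hfd : ∀ x ∈ G.domain, fderiv ℝ χ x = fderiv ℝ χ' x := fun x hx =>
    ((heq.eventuallyEq_of_mem (G.isOpen_domain.mem_nhds hx)).symm).fderiv_eq
  have e1 : ∫ x, G.domain.indicator (fn u) x * fderiv ℝ χ x v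
      = ∫ x in G.domain, fn u x * fderiv ℝ χ' x v := by
    rw [← integral_indicator hm]
    refine integral_congr_ae (Filter.Eventually.of_forall fun x => ?_)
    by_cases hx : x ∈ G.domain <;> simp [hx, hfd]
  have e2 : ∫ x, inner ℝ (G.domain.indicator (wgrad u) x) v * χ x
      = ∫ x in G.domain, inner ℝ (wgrad u x) v * χ' x := by
    rw [← integral_indicator hm]
    refine integral_congr_ae (Filter.Eventually.of_forall fun x => ?_)
    by_cases hx : x ∈ G.domain
    · simp [hx, heq hx]
    · simp [hx]
  -- expand `v` in the standard basis
  have hv : v = ∑ i, v i • EuclideanSpace.single i (1 : ℝ) := by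
    ext j
    simp [Finset.sum_apply, Pi.single_apply]
  have e3 : ∀ x, fn u x * fderiv ℝ χ' x v
      = ∑ i, v i * (fn u x * fderiv ℝ χ' x (EuclideanSpace.single i 1)) := fun x => by
    conv_lhs => rw [hv]
    rw [map_sum, Finset.mul_sum]
    refine Finset.sum_congr rfl fun i _ => ?_
    rw [map_smul, smul_eq_mul]
    ring
  have e4 : ∀ x, inner ℝ (wgrad u x) v * χ' x = ∑ i, v i * (wgrad u x i * χ' x) := fun x => by
    rw [PiLp.inner_apply, Finset.sum_mul]
    refine Finset.sum_congr rfl fun i _ => ?_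
    simp
    ring
  rw [e1, e2]
  simp only [e3, e4]
  rw [integral_finsetSum _ fun i _ => (integrable_fst G hχ' i (fn u)).const_mul (v i),
    integral_finsetSum _ fun i _ => (integrable_snd G hχ' i (wgrad u)).const_mul (v i),
    ← Finset.sum_neg_distrib]
  refine Finset.sum_congr rfl fun i _ => ?_
  rw [integral_const_mul, integral_const_mul, ← mul_neg]
  congr 1
  exact u.2 χ' hχ' i

/-- The oscillation of a function of mean zero dominates its `L²` norm. -/
theorem volume_mul_le_l2Oscillation {G : Geometry d} {u : L2 G} (hu : u ∈ L2MeanFree G) :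
    volume G.domain * ‖u‖ₑ ^ 2
      ≤ l2Oscillation (G.domain.indicator u) G.domain G.domain := by
  have hm := G.isOpen_domain.measurableSet
  have hu1 : Integrable u G.vol := (Lp.memLp u).integrable one_le_two
  have hu2 : Integrable (fun x => u x ^ 2) G.vol := (Lp.memLp u).integrable_sq
  have hvol : G.vol.real Set.univ = volume.real G.domain := by simp [Measure.real]
  have hpt : ∀ a : ℝ, volume G.domain * ‖a‖ₑ ^ 2 ≤ ∫⁻ y in G.domain, ‖a - u y‖ₑ ^ 2 := by
    intro a
    have hint : Integrable (fun y => (a - u y) ^ 2) G.vol :=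
      ((memLp_const a).sub (Lp.memLp u)).integrable_sq
    have e1 : ∫⁻ y in G.domain, ‖a - u y‖ₑ ^ 2
        = ENNReal.ofReal (∫ y in G.domain, (a - u y) ^ 2) := by
      rw [ofReal_integral_eq_lintegral_ofReal hint
        (Filter.Eventually.of_forall fun y => sq_nonneg _)]
      refine lintegral_congr fun y => ?_
      rw [← sq_abs, ENNReal.ofReal_pow (abs_nonneg _), ← Real.norm_eq_abs, ofReal_norm]
    have e2 : ∫ y in G.domain, (a - u y) ^ 2
        = volume.real G.domain * a ^ 2 + ∫ y in G.domain, u y ^ 2 := by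
      have h1 : ∀ y, (a - u y) ^ 2 = (a ^ 2 - 2 * a * u y) + u y ^ 2 := fun y => by ring
      have i1 : Integrable (fun _ : Space d => a ^ 2) G.vol := integrable_const _
      have i2 : Integrable (fun y => 2 * a * u y) G.vol := hu1.const_mul _
      have i3 : Integrable (fun y => a ^ 2 - 2 * a * u y) G.vol := i1.sub i2
      simp only [h1]
      rw [integral_add i3 hu2, integral_sub i1 i2, integral_const_mul,
        show ∫ y in G.domain, u y = 0 from hu, integral_const, hvol]
      simp
    have e3 : volume G.domain * ‖a‖ₑ ^ 2 = ENNReal.ofReal (volume.real G.domain * a ^ 2) := by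
      rw [ENNReal.ofReal_mul measureReal_nonneg, ofReal_measureReal G.volume_domain_ne_top,
        ← sq_abs, ENNReal.ofReal_pow (abs_nonneg _), ← Real.norm_eq_abs, ofReal_norm]
    rw [e1, e2, e3]
    refine ENNReal.ofReal_le_ofReal ?_
    have : 0 ≤ ∫ y in G.domain, u y ^ 2 := integral_nonneg fun y => sq_nonneg _
    linarith
  have e4 : volume G.domain * ‖u‖ₑ ^ 2 = ∫⁻ x in G.domain, volume G.domain * ‖u x‖ₑ ^ 2 := by
    have h2 := eLpNorm_nnreal_pow_eq_lintegral (p := 2) (f := u) (μ := G.vol) (by norm_num)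
    rw [lintegral_const_mul _ ((Lp.stronglyMeasurable u).measurable.enorm.pow_const 2),
      Lp.enorm_def]
    congr 1
    norm_num at h2
    exact_mod_cast h2
  rw [e4]
  unfold l2Oscillation
  refine setLIntegral_mono' hm fun x hx => (hpt (u x)).trans (le_of_eq ?_)
  refine setLIntegral_congr_fun hm fun y hy => ?_
  simp [hx, hy]

/-- The Poincaré–Wirtinger inequality. -/
theorem exists_norm_fn_le_norm_wgrad (G : Geometry d) :
    ∃ C : ℝ, 0 ≤ C ∧ ∀ u : H1MeanFree G, ‖fn u.1‖ ^ 2 ≤ C * ‖wgrad u.1‖ ^ 2 := by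
  obtain ⟨C, hC, hosc⟩ := G.oscillationBound
  refine ⟨(C / volume G.domain).toReal, ENNReal.toReal_nonneg, fun u => ?_⟩
  have h1 := (volume_mul_le_l2Oscillation u.2).trans
    (hosc _ _ (isWeakGradientOn_indicator u.1))
  rw [eLpNorm_indicator_eq_eLpNorm_restrict G.isOpen_domain.measurableSet, ← Lp.enorm_def,
    mul_comm] at h1
  rw [← ENNReal.le_div_iff_mul_le (Or.inl G.volume_domain_ne_zero)
    (Or.inl G.volume_domain_ne_top)] at h1
  have hfin : C / volume G.domain ≠ ⊤ := ENNReal.div_ne_top hC G.volume_domain_ne_zero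
  have h2 : ‖fn u.1‖ₑ ^ 2 ≤ C / volume G.domain * ‖wgrad u.1‖ₑ ^ 2 := by
    refine h1.trans (le_of_eq ?_)
    simp only [div_eq_mul_inv]
    ring
  have h3 := ENNReal.toReal_mono (ENNReal.mul_ne_top hfin (by finiteness)) h2
  simpa using h3

end Domain

/-! ### Constants belong to `H¹(Ω)` -/

section Constants

open scoped ENNReal Topology

variable {d : ℕ}

/-- The integral over a box of a partial derivative of a periodic function vanishes: in the
divergence theorem opposite faces cancel. -/
theorem integral_fderiv_periodic {ℓ : Fin d → ℝ} (hℓ : ∀ i, 0 < ℓ i) {χ : Space d → ℝ}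
    (hχ : ContDiff ℝ ∞ χ)
    (hper : ∀ (i : Fin d) (x : Space d), χ (x + EuclideanSpace.single i (ℓ i)) = χ x)
    (i : Fin d) :
    ∫ x in (Geometry.periodic ℓ hℓ).domain, fderiv ℝ χ x (EuclideanSpace.single i 1) = 0 := by
  obtain _ | n := d
  · exact i.elim0
  have hcf : Continuous fun x => fderiv ℝ χ x (EuclideanSpace.single i 1) :=
    (hχ.continuous_fderiv (by simp)).clm_apply continuous_const
  have hcl : Continuous (WithLp.toLp 2 : (Fin (n + 1) → ℝ) → Space (n + 1)) :=
    PiLp.continuous_toLp 2 _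
  have e1 : ∫ x in (Geometry.periodic ℓ hℓ).domain, fderiv ℝ χ x (EuclideanSpace.single i 1)
      = ∫ y in Set.Icc 0 ℓ, fderiv ℝ χ (WithLp.toLp 2 y) (EuclideanSpace.single i 1) := by
    have h1 := (PiLp.volume_preserving_ofLp (Fin (n + 1))).setIntegral_preimage_emb
      (MeasurableEquiv.toLp 2 (Fin (n + 1) → ℝ)).symm.measurableEmbedding
      (fun y => fderiv ℝ χ (WithLp.toLp 2 y) (EuclideanSpace.single i 1))
      (Set.pi Set.univ fun i => Set.Ioo (0 : ℝ) (ℓ i))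
    rw [Geometry.domain_periodic_eq]
    refine h1.trans ?_
    exact setIntegral_congr_set (Measure.univ_pi_Ioo_ae_eq_Icc (f := fun _ => (0 : ℝ)) (g := ℓ))
  rw [e1]
  set T : (Fin (n + 1) → ℝ) →L[ℝ] Space (n + 1) :=
    (PiLp.continuousLinearEquiv 2 ℝ fun _ : Fin (n + 1) => ℝ).symm.toContinuousLinearMap with hT
  have hTa : ∀ y, T y = WithLp.toLp 2 y := fun y => rfl
  have hdiv := integral_divergence_of_hasFDerivAt_off_countable' (n := n) 0 ℓ
    (fun j => (hℓ j).le) (fun j y => if j = i then χ (WithLp.toLp 2 y) else 0)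
    (fun j y => if j = i then (fderiv ℝ χ (T y)).comp T else 0) ∅ Set.countable_empty
    (fun j => by
      by_cases hj : j = i
      · simp only [hj, if_true]
        exact (hχ.continuous.comp hcl).continuousOn
      · simp only [hj, if_false]
        exact continuousOn_const)
    (fun y _ j => by
      by_cases hj : j = i
      · simp only [hj, if_true]
        exact ((hχ.differentiable (by simp)) (T y)).hasFDerivAt.comp y T.hasFDerivAt
      · simp only [hj, if_false]
        exact hasFDerivAt_const _ _)
    (by
      have hc : Continuous fun y => ∑ j : Fin (n + 1),
          (if j = i then (fderiv ℝ χ (T y)).comp T else 0) (Pi.single j 1) := by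
        refine continuous_finsetSum _ fun j _ => ?_
        by_cases hj : j = i
        · simp only [hj, if_true]
          exact ((hχ.continuous_fderiv (by simp)).comp T.continuous).clm_apply continuous_const
        · simp only [hj, if_false]
          exact continuous_const
      exact hc.continuousOn.integrableOn_compact isCompact_Icc)
  have e2 : ∀ y : Fin (n + 1) → ℝ, ∑ j : Fin (n + 1),
      (if j = i then (fderiv ℝ χ (T y)).comp T else 0) (Pi.single j 1)
      = fderiv ℝ χ (WithLp.toLp 2 y) (EuclideanSpace.single i 1) := fun y => by
    rw [Finset.sum_eq_single i (fun j _ hj => by simp [hj]) (by simp)]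
    simp only [if_true]
    rfl
  simp only [e2] at hdiv
  rw [hdiv]
  refine Finset.sum_eq_zero fun j _ => sub_eq_zero.2 ?_
  by_cases hj : j = i
  · subst hj
    simp only [if_true]
    refine integral_congr_ae (Filter.Eventually.of_forall fun y => ?_)
    have h1 : (WithLp.toLp 2 (j.insertNth (ℓ j) y) : Space (n + 1))
        = WithLp.toLp 2 (j.insertNth ((0 : Fin (n + 1) → ℝ) j) y)
          + EuclideanSpace.single j (ℓ j) := by
      ext k
      refine Fin.succAboveCases j ?_ (fun k => ?_) k
      · simp
      · simp [Fin.succAbove_ne]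
    change χ (WithLp.toLp 2 (j.insertNth (ℓ j) y)) = _
    rw [h1, hper]
  · simp [hj]

/-- Test functions have partial derivatives of integral zero: the weak gradient of a constant is
zero. -/
theorem integral_fderiv_testFunction {G : Geometry d} {χ : Space d → ℝ} (hχ : χ ∈ G.testFunctions)
    (i : Fin d) : ∫ x in G.domain, fderiv ℝ χ x (EuclideanSpace.single i 1) = 0 := by
  cases G with
  | periodic ℓ hℓ => exact integral_fderiv_periodic hℓ hχ.1 hχ.2 i
  | neumann Ω hΩ h2 h3 h4 =>
    obtain ⟨hd, hc, hs⟩ := hχ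
    have hcf : Continuous fun x => fderiv ℝ χ x (EuclideanSpace.single i 1) :=
      (hd.continuous_fderiv (by simp)).clm_apply continuous_const
    have hcs : HasCompactSupport fun x => fderiv ℝ χ x (EuclideanSpace.single i 1) :=
      hc.fderiv_apply (𝕜 := ℝ) _
    have h := integral_mul_fderiv_eq_neg_fderiv_mul_of_integrable (μ := volume)
      (f := fun _ : Space d => (1 : ℝ)) (g := χ) (v := EuclideanSpace.single i 1)
      (by simp) (by simpa using hcf.integrable_of_hasCompactSupport hcs)
      (by simpa using hd.continuous.integrable_of_hasCompactSupport hc)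
      (fun x _ => differentiableAt_const _) (fun x _ => (hd.differentiable (by simp)) x)
    simp only [one_mul, fderiv_fun_const, Pi.zero_apply, zero_apply, zero_mul,
      integral_zero, neg_zero] at h
    rw [← h]
    refine setIntegral_eq_integral_of_forall_compl_eq_zero fun x hx => ?_
    have : x ∉ tsupport (fderiv ℝ χ) := fun h' => hx (hs (tsupport_fderiv_subset ℝ h'))
    rw [image_eq_zero_of_notMem_tsupport this]
    rfl

/-- The constant function `c` as an element of `H¹(Ω)`. -/
noncomputable def constH1 (G : Geometry d) (c : ℝ) : H1 G :=
  ⟨WithLp.toLp 2 (Lp.const 2 G.vol c, 0), fun χ hχ i => by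
    have h1 : ∫ x in G.domain, (Lp.const 2 G.vol c) x * fderiv ℝ χ x (EuclideanSpace.single i 1)
        = 0 := by
      rw [integral_congr_ae (g := fun x => c * fderiv ℝ χ x (EuclideanSpace.single i 1)) ?_,
        integral_const_mul, integral_fderiv_testFunction hχ, mul_zero]
      filter_upwards [Lp.coeFn_const 2 G.vol c] with x hx
      rw [hx, Function.const_apply]
    have h2 : ∫ x in G.domain, (0 : L2Vec G) x i * χ x = 0 := by
      rw [← integral_zero (Space d) ℝ (μ := G.vol)]
      refine integral_congr_ae ?_
      filter_upwards [Lp.coeFn_zero (Space d) 2 G.vol] with x hx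
      simp only [hx, Pi.zero_apply, PiLp.zero_apply, zero_mul]
    exact h1.trans (by rw [← neg_zero, ← h2]; rfl)⟩

@[simp] theorem fn_constH1 (G : Geometry d) (c : ℝ) : fn (constH1 G c) = Lp.const 2 G.vol c := rfl

@[simp] theorem wgrad_constH1 (G : Geometry d) (c : ℝ) : wgrad (constH1 G c) = 0 := rfl

end Constants

/-! ### Bounded bilinear forms and the Lax–Milgram theorem -/

section Forms

variable {V W L : Type*} [NormedAddCommGroup V] [InnerProductSpace ℝ V]
  [NormedAddCommGroup W] [InnerProductSpace ℝ W] [NormedAddCommGroup L] [InnerProductSpace ℝ L]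

/-- The bounded bilinear form `(v, w) ↦ ⟪a v, b w⟫`. -/
noncomputable def innerForm (a : V →L[ℝ] L) (b : W →L[ℝ] L) : V →L[ℝ] StrongDual ℝ W :=
  LinearMap.mkContinuous₂
    (LinearMap.mk₂ ℝ (fun v w => inner ℝ (a v) (b w))
      (fun _ _ _ => by rw [map_add, inner_add_left])
      (fun _ _ _ => by rw [map_smul, real_inner_smul_left, smul_eq_mul])
      (fun _ _ _ => by rw [map_add, inner_add_right])
      (fun _ _ _ => by rw [map_smul, real_inner_smul_right, smul_eq_mul]))
    (‖a‖ * ‖b‖) fun v w => by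
      refine (norm_inner_le_norm _ _).trans ?_
      calc ‖a v‖ * ‖b w‖ ≤ (‖a‖ * ‖v‖) * (‖b‖ * ‖w‖) :=
            mul_le_mul (a.le_opNorm v) (b.le_opNorm w) (norm_nonneg _) (by positivity)
        _ = ‖a‖ * ‖b‖ * ‖v‖ * ‖w‖ := by ring

/-- Lax–Milgram: a coercive form identifies the space with its dual. -/
theorem exists_rightInverse_of_coercive [CompleteSpace V] {B : V →L[ℝ] StrongDual ℝ V} {C : ℝ}
    (hC : 0 < C) (hB : ∀ v, C * ‖v‖ ^ 2 ≤ B v v) :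
    Function.Injective B ∧ ∃ S : StrongDual ℝ V →L[ℝ] V, ∀ l, B (S l) = l := by
  have hco : IsCoercive B := ⟨C, hC, fun v => by rw [mul_assoc, ← sq]; exact hB v⟩
  have hinj : Function.Injective B := fun v w h =>
    hco.continuousLinearEquivOfBilin.injective (ext_inner_right ℝ fun z => by
      rw [hco.continuousLinearEquivOfBilin_apply, hco.continuousLinearEquivOfBilin_apply, h])
  have hsurj : Function.Surjective B := fun l => by
    refine ⟨hco.continuousLinearEquivOfBilin.symm ((InnerProductSpace.toDual ℝ V).symm l), ?_⟩
    ext w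
    rw [← hco.continuousLinearEquivOfBilin_apply, ContinuousLinearEquiv.apply_symm_apply,
      InnerProductSpace.toDual_symm_apply]
  let e := ContinuousLinearEquiv.ofBijective B (LinearMap.ker_eq_bot.2 hinj)
    (LinearMap.range_eq_top.2 hsurj)
  exact ⟨hinj, e.symm.toContinuousLinearMap, fun l =>
    ContinuousLinearEquiv.ofBijective_apply_symm_apply B _ _ l⟩

/-- Solution operator of a coercive variational problem `⟪a v, b w⟫ = -⟪k u, j w⟫`. -/
theorem exists_solutionOperator [CompleteSpace V] {U E : Type*} [NormedAddCommGroup U]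
    [InnerProductSpace ℝ U] [NormedAddCommGroup E] [InnerProductSpace ℝ E]
    (a b : V →L[ℝ] E) (k : U →L[ℝ] L) (j : V →L[ℝ] L) {C : ℝ} (hC : 0 < C)
    (h : ∀ v, C * ‖v‖ ^ 2 ≤ inner ℝ (a v) (b v)) :
    ∃ R : U →L[ℝ] V, ∀ u v, R u = v ↔ ∀ w, inner ℝ (a v) (b w) = -inner ℝ (k u) (j w) := by
  obtain ⟨hinj, S, hS⟩ := exists_rightInverse_of_coercive (B := innerForm a b) hC h
  refine ⟨S.comp (-innerForm k j), fun u v => ?_⟩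
  have h1 : innerForm a b (S (-innerForm k j u)) = -innerForm k j u := hS _
  have h2 : (∀ w, inner ℝ (a v) (b w) = -inner ℝ (k u) (j w))
      ↔ innerForm a b v = -innerForm k j u := by
    rw [ContinuousLinearMap.ext_iff]
    rfl
  rw [h2, ← h1]
  exact ⟨fun h => congrArg _ h.symm, fun h => (hinj h).symm⟩

/-- The bounded bilinear form `s₁ ⟪r v, j w⟫ + (s₂ ⟪g v, g w⟫ + s₃ ⟪t v, t w⟫)`. -/
theorem exists_bilinearForm {E : Type*} [NormedAddCommGroup E] [InnerProductSpace ℝ E]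
    (r j t : V →L[ℝ] L) (g : V →L[ℝ] E) (s₁ s₂ s₃ : ℝ) :
    ∃ A : V →L[ℝ] StrongDual ℝ V, ∀ v w, A v w
      = s₁ * inner ℝ (r v) (j w) + (s₂ * inner ℝ (g v) (g w) + s₃ * inner ℝ (t v) (t w)) :=
  ⟨s₁ • innerForm r j + (s₂ • innerForm g g + s₃ • innerForm t t), fun _ _ => rfl⟩

/-- Unique solvability of a coercive variational problem. -/
theorem existsUnique_of_coercive [CompleteSpace V] {A : V →L[ℝ] StrongDual ℝ V} {C : ℝ}
    (hC : 0 < C) (hA : ∀ v, C * ‖v‖ ^ 2 ≤ A v v) (j t : V →L[ℝ] L) (β β' : L) :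
    ∃! v, ∀ w, A v w = inner ℝ β (j w) + inner ℝ β' (t w) := by
  obtain ⟨hinj, S, hS⟩ := exists_rightInverse_of_coercive hC hA
  set l : StrongDual ℝ V := innerForm (ContinuousLinearMap.id ℝ L) j β
    + innerForm (ContinuousLinearMap.id ℝ L) t β'
  refine ⟨S l, fun w => by rw [hS]; rfl, fun v hv => hinj ?_⟩
  rw [hS]
  ext w
  exact hv w

end Forms

/-! ### Multiplication by bounded functions -/

/-- Multiplication by a bounded measurable function as a bounded operator on `L²`. -/
theorem exists_mul_operator {X F : Type*} [MeasurableSpace X] {μ : Measure X}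
    [NormedAddCommGroup F] [InnerProductSpace ℝ F] {m : X → ℝ} (hm : AEStronglyMeasurable m μ)
    {K : ℝ} (hK : ∀ x, |m x| ≤ K) :
    ∃ T : Lp F 2 μ →L[ℝ] Lp F 2 μ, ∀ f : Lp F 2 μ, T f =ᵐ[μ] fun x => m x • f x := by
  have hle : ∀ (f : Lp F 2 μ) x, ‖m x • f x‖ ≤ K * ‖f x‖ := fun f x => by
    rw [norm_smul, Real.norm_eq_abs]
    exact mul_le_mul_of_nonneg_right (hK x) (norm_nonneg _)
  have hmem : ∀ f : Lp F 2 μ, MemLp (fun x => m x • f x) 2 μ := fun f =>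
    (Lp.memLp f).of_le_mul (hm.smul (Lp.aestronglyMeasurable f))
      (Filter.Eventually.of_forall (hle f))
  let T₀ : Lp F 2 μ →ₗ[ℝ] Lp F 2 μ :=
    { toFun := fun f => (hmem f).toLp _
      map_add' := fun f g => by
        refine Lp.ext ?_
        filter_upwards [(hmem (f + g)).coeFn_toLp, (hmem f).coeFn_toLp, (hmem g).coeFn_toLp,
          Lp.coeFn_add ((hmem f).toLp _) ((hmem g).toLp _), Lp.coeFn_add f g]
          with x h1 h2 h3 h4 h5
        rw [h1, h4, Pi.add_apply, h2, h3, h5, Pi.add_apply, smul_add]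
      map_smul' := fun c f => by
        refine Lp.ext ?_
        filter_upwards [(hmem (c • f)).coeFn_toLp, (hmem f).coeFn_toLp,
          Lp.coeFn_smul c ((hmem f).toLp _), Lp.coeFn_smul c f] with x h1 h2 h3 h4
        rw [h1, RingHom.id_apply, h3, Pi.smul_apply, h2, h4, Pi.smul_apply, smul_comm] }
  refine ⟨T₀.mkContinuous K fun f => ?_, fun f => (hmem f).coeFn_toLp⟩
  refine Lp.norm_le_mul_norm_of_ae_le_mul ?_
  filter_upwards [(hmem f).coeFn_toLp] with x hx
  change ‖((hmem f).toLp _ : Lp F 2 μ) x‖ ≤ _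
  rw [hx]
  exact hle f x

/-! ### The Hilbert space structure of `H¹(Ω)` -/

section HilbertSpace

variable {d : ℕ}

theorem norm_sq_eq_fn_add_wgrad {G : Geometry d} (u : H1 G) :
    ‖u‖ ^ 2 = ‖fn u‖ ^ 2 + ‖wgrad u‖ ^ 2 :=
  WithLp.prod_norm_sq_eq_of_L2 u.1

/-- `fn` as a bounded operator. -/
noncomputable def fnL (G : Geometry d) : H1 G →L[ℝ] L2 G :=
  LinearMap.mkContinuous { toFun := fn, map_add' := fun _ _ => rfl, map_smul' := fun _ _ => rfl } 1
    fun u => by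
      rw [one_mul]
      refine le_of_sq_le_sq ?_ (norm_nonneg u)
      have := norm_sq_eq_fn_add_wgrad u
      change ‖fn u‖ ^ 2 ≤ _
      nlinarith [sq_nonneg ‖wgrad u‖]

/-- `wgrad` as a bounded operator. -/
noncomputable def wgradL (G : Geometry d) : H1 G →L[ℝ] L2Vec G :=
  LinearMap.mkContinuous { toFun := wgrad, map_add' := fun _ _ => rfl, map_smul' := fun _ _ => rfl }
    1 fun u => by
      rw [one_mul]
      refine le_of_sq_le_sq ?_ (norm_nonneg u)
      have := norm_sq_eq_fn_add_wgrad u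
      change ‖wgrad u‖ ^ 2 ≤ _
      nlinarith [sq_nonneg ‖fn u‖]

theorem fn_mem_L2MeanFree {G : Geometry d} (u : H1MeanFree G) : fn u.1 ∈ L2MeanFree G := u.2

theorem fn_add {G : Geometry d} (u v : H1 G) : fn (u + v) = fn u + fn v := rfl

theorem fn_sub {G : Geometry d} (u v : H1 G) : fn (u - v) = fn u - fn v := rfl

theorem fn_smul {G : Geometry d} (c : ℝ) (u : H1 G) : fn (c • u) = c • fn u := rfl

theorem wgrad_add {G : Geometry d} (u v : H1 G) : wgrad (u + v) = wgrad u + wgrad v := rfl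

theorem wgrad_sub {G : Geometry d} (u v : H1 G) : wgrad (u - v) = wgrad u - wgrad v := rfl

theorem wgrad_smul {G : Geometry d} (c : ℝ) (u : H1 G) : wgrad (c • u) = c • wgrad u := rfl

theorem integral_mul_eq_inner {G : Geometry d} (f g : L2 G) :
    ∫ x in G.domain, f x * g x = inner ℝ f g := by
  rw [L2.inner_def]
  refine integral_congr_ae (Filter.Eventually.of_forall fun x => ?_)
  simp [mul_comm]

theorem integral_inner_eq_inner {G : Geometry d} (f g : L2Vec G) :
    ∫ x in G.domain, inner ℝ (f x) (g x) = inner ℝ f g := (L2.inner_def f g).symm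

theorem integral_mul_eq_inner_toLp {G : Geometry d} (f : L2 G) {a : Space d → ℝ}
    (ha : MemLp a 2 G.vol) : ∫ x in G.domain, f x * a x = inner ℝ f (ha.toLp a) := by
  rw [← integral_mul_eq_inner]
  refine integral_congr_ae ?_
  filter_upwards [ha.coeFn_toLp] with x hx
  rw [hx]

theorem inner_const_right {G : Geometry d} (f : L2 G) (c : ℝ) :
    inner ℝ f (Lp.const 2 G.vol c) = c * ∫ x in G.domain, f x := by
  rw [← integral_mul_eq_inner, ← integral_const_mul]
  refine integral_congr_ae ?_
  filter_upwards [Lp.coeFn_const 2 G.vol c] with x hx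
  rw [hx, Function.const_apply, mul_comm]

theorem integral_Lp_const (G : Geometry d) (c : ℝ) :
    ∫ x in G.domain, (Lp.const 2 G.vol c) x = volume.real G.domain * c := by
  rw [integral_congr_ae (Lp.coeFn_const 2 G.vol c)]
  simp [Measure.real]

theorem volume_real_domain_pos (G : Geometry d) : 0 < volume.real G.domain :=
  ENNReal.toReal_pos G.volume_domain_ne_zero G.volume_domain_ne_top

theorem volume_mul_mean {G : Geometry d} (u : L2 G) :
    volume.real G.domain * mean u = ∫ x in G.domain, u x := by
  rw [mean, setAverage_eq, smul_eq_mul, mul_inv_cancel_left₀ (volume_real_domain_pos G).ne']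

theorem mem_L2MeanFree_iff_inner {G : Geometry d} (u : L2 G) :
    u ∈ L2MeanFree G ↔ inner ℝ u (Lp.const 2 G.vol (1 : ℝ)) = 0 := by
  rw [inner_const_right, one_mul]
  rfl

theorem inner_const_of_meanFree {G : Geometry d} {u : L2 G} (hu : u ∈ L2MeanFree G) (c : ℝ) :
    inner ℝ u (Lp.const 2 G.vol c) = 0 := by
  rw [inner_const_right, show ∫ x in G.domain, u x = 0 from hu, mul_zero]

/-- The defining relations of `H¹(Ω)` are closed, hence `H¹(Ω)` is complete. -/
instance (G : Geometry d) : CompleteSpace (H1 G) := by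
  have hclosed : IsClosed (H1 G : Set (WithLp 2 (L2 G × L2Vec G))) := by
    have hset : (H1 G : Set (WithLp 2 (L2 G × L2Vec G)))
        = ⋂ χ ∈ G.testFunctions, ⋂ i : Fin d, {p |
          ∫ x in G.domain, p.fst x * fderiv ℝ χ x (EuclideanSpace.single i 1)
            = -∫ x in G.domain, p.snd x i * χ x} := by
      ext p
      simp only [Set.mem_iInter]
      rfl
    rw [hset]
    refine isClosed_biInter fun χ hχ => isClosed_iInter fun i => ?_
    have ha : MemLp (fun x => fderiv ℝ χ x (EuclideanSpace.single i 1)) 2 G.vol :=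
      G.memLp_of_continuous
        (((G.contDiff_of_mem hχ).continuous_fderiv (by simp)).clm_apply continuous_const)
    have hb : MemLp χ 2 G.vol := G.memLp_of_continuous (G.contDiff_of_mem hχ).continuous
    have hbe : MemLp (fun x => χ x • EuclideanSpace.single i (1 : ℝ)) 2 G.vol :=
      ((ContinuousLinearMap.id ℝ ℝ).smulRight
        (EuclideanSpace.single i (1 : ℝ))).comp_memLp' hb
    have e1 : ∀ p : WithLp 2 (L2 G × L2Vec G),
        ∫ x in G.domain, p.snd x i * χ x = inner ℝ p.snd (hbe.toLp _) := fun p => by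
      rw [L2.inner_def]
      refine integral_congr_ae ?_
      filter_upwards [hbe.coeFn_toLp] with x hx
      rw [hx, real_inner_smul_right, EuclideanSpace.inner_single_right]
      simp [mul_comm]
    simp only [integral_mul_eq_inner_toLp _ ha, e1]
    have c1 : Continuous fun p : WithLp 2 (L2 G × L2Vec G) => p.fst :=
      continuous_fst.comp (WithLp.prod_continuous_ofLp 2 _ _)
    have c2 : Continuous fun p : WithLp 2 (L2 G × L2Vec G) => p.snd :=
      continuous_snd.comp (WithLp.prod_continuous_ofLp 2 _ _)
    exact isClosed_eq (c1.inner continuous_const) (c2.inner continuous_const).neg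
  exact hclosed.completeSpace_coe

instance (G : Geometry d) : CompleteSpace (H1MeanFree G) := by
  have hclosed : IsClosed (H1MeanFree G : Set (H1 G)) := by
    have hset : (H1MeanFree G : Set (H1 G))
        = {u | inner ℝ (fnL G u) (Lp.const 2 G.vol (1 : ℝ)) = 0} := by
      ext u
      exact mem_L2MeanFree_iff_inner (fn u)
    rw [hset]
    exact isClosed_eq ((fnL G).continuous.inner continuous_const) continuous_const
  exact hclosed.completeSpace_coe

/-- The weak gradient is determined by the function. -/
theorem fn_injective (G : Geometry d) : Function.Injective (fn : H1 G → L2 G) := by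
  have h0 : ∀ u : H1 G, fn u = 0 → wgrad u = 0 := by
    intro u hu
    have hcomp : ∀ i : Fin d, ∀ᵐ x ∂G.vol, wgrad u x i = 0 := by
      intro i
      have hmem : MemLp (fun x => wgrad u x i) 2 G.vol :=
        (EuclideanSpace.proj (𝕜 := ℝ) i : Space d →L[ℝ] ℝ).comp_memLp' (Lp.memLp (wgrad u))
      have hloc : LocallyIntegrableOn (fun x => wgrad u x i) G.domain volume :=
        locallyIntegrableOn_of_locallyIntegrable_restrict (hmem.locallyIntegrable one_le_two)
      refine (ae_restrict_iff' G.isOpen_domain.measurableSet).2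
        (G.isOpen_domain.ae_eq_zero_of_integral_contDiff_smul_eq_zero hloc fun χ h1 h2 h3 => ?_)
      obtain ⟨χ', hχ', heq⟩ := G.exists_testFunction_eqOn h1 h2 h3
      have h4 := u.2 χ' hχ' i
      have h5 : ∫ x in G.domain, u.1.fst x * fderiv ℝ χ' x (EuclideanSpace.single i 1) = 0 := by
        rw [← integral_zero (Space d) ℝ (μ := G.vol)]
        refine integral_congr_ae ?_
        filter_upwards [Lp.coeFn_zero ℝ 2 G.vol] with x hx
        rw [show u.1.fst = 0 from hu, hx, Pi.zero_apply, zero_mul]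
      rw [h5, eq_comm, neg_eq_zero] at h4
      rw [← setIntegral_eq_integral_of_forall_compl_eq_zero (s := G.domain) fun x hx => by
        rw [image_eq_zero_of_notMem_tsupport fun h' => hx (h3 h'), zero_smul], ← h4]
      refine setIntegral_congr_fun G.isOpen_domain.measurableSet fun x hx => ?_
      simp only [heq hx, smul_eq_mul, mul_comm]
      rfl
    rw [Lp.eq_zero_iff_ae_eq_zero]
    filter_upwards [ae_all_iff.2 hcomp] with x hx
    ext i
    exact hx i
  intro u v huv
  have h1 : fn (u - v) = 0 := by
    rw [fn_sub, huv, sub_self]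
  have h2 := norm_sq_eq_fn_add_wgrad (u - v)
  rw [h0 _ h1, h1, norm_zero, norm_zero] at h2
  have h3 : ‖u - v‖ = 0 := by nlinarith [norm_nonneg (u - v)]
  exact sub_eq_zero.1 (norm_eq_zero.1 h3)

/-- Removing the mean of an element of `H¹(Ω)`. -/
theorem sub_constH1_mem {G : Geometry d} (u : H1 G) {c : ℝ} (hc : mean (fn u) = c) :
    u - constH1 G c ∈ H1MeanFree G := by
  subst hc
  exact (meanFree (fn u)).2

/-- By the Poincaré inequality, the gradient controls the full norm of `H¹(Ω)` on mean-free
functions. -/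
theorem exists_mul_norm_sq_le_of_wgrad {G : Geometry d} {q : H1MeanFree G → ℝ} {c : ℝ}
    (hc : 0 < c) (hq : ∀ v, c * ‖wgrad v.1‖ ^ 2 ≤ q v) :
    ∃ C : ℝ, 0 < C ∧ ∀ v, C * ‖v‖ ^ 2 ≤ q v := by
  obtain ⟨K, hK, h⟩ := exists_norm_fn_le_norm_wgrad G
  refine ⟨c / (K + 1), by positivity, fun v => le_trans ?_ (hq v)⟩
  have h1 := norm_sq_eq_fn_add_wgrad v.1
  have h2 : ‖v‖ = ‖v.1‖ := rfl
  rw [h2, h1, div_mul_eq_mul_div, div_le_iff₀ (by positivity)]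
  nlinarith [h v]

end HilbertSpace

/-! ### The weighted inverse Laplacian and the reduction of the system -/

section Scheme

variable {d : ℕ} {G : Geometry d}

/-- The mean-free part of `H¹(Ω)` inside `L²(Ω)`. -/
noncomputable def fnV (G : Geometry d) : H1MeanFree G →L[ℝ] L2 G :=
  (fnL G).comp (H1MeanFree G).subtypeL

/-- The weak gradient on the mean-free part of `H¹(Ω)`. -/
noncomputable def wgradV (G : Geometry d) : H1MeanFree G →L[ℝ] L2Vec G :=
  (wgradL G).comp (H1MeanFree G).subtypeL

/-- `toL2MeanFree` as a bounded operator. -/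
noncomputable def toL2MeanFreeL (G : Geometry d) : H1MeanFree G →L[ℝ] L2MeanFree G :=
  (fnV G).codRestrict (L2MeanFree G) fun u => u.2

/-- Multiplication by the mobility `M(φⁿ)` on `L²(Ω)^d`; it represents the weighted Dirichlet form
and is bounded below. -/
theorem exists_mobility_operator {M : ℝ → ℝ} (hM : IsAdmissibleMobility M) (φn : L2 G) :
    ∃ T : L2Vec G →L[ℝ] L2Vec G,
      (∀ v w : H1 G, diffusionForm M φn v w = inner ℝ (T (wgrad v)) (wgrad w)) ∧
      ∃ c > 0, ∀ v : H1 G, c * ‖wgrad v‖ ^ 2 ≤ inner ℝ (T (wgrad v)) (wgrad v) := by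
  obtain ⟨hMm, L₁, L₂, hL₂, hb⟩ := hM
  have hm : AEStronglyMeasurable (fun x => M (φn x)) G.vol :=
    (hMm.comp (Lp.stronglyMeasurable φn).measurable).aestronglyMeasurable
  obtain ⟨T, hT⟩ := exists_mul_operator (F := Space d) hm (K := L₁) fun x => by
    rw [abs_of_nonneg (hL₂.le.trans (hb _).1)]
    exact (hb _).2
  have hD : ∀ v w : H1 G, diffusionForm M φn v w = inner ℝ (T (wgrad v)) (wgrad w) := by
    intro v w
    rw [L2.inner_def]
    refine integral_congr_ae ?_
    filter_upwards [hT (wgrad v)] with x hx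
    rw [hx, real_inner_smul_left]
  refine ⟨T, hD, L₂, hL₂, fun v => ?_⟩
  rw [← real_inner_self_eq_norm_sq, L2.inner_def, L2.inner_def, ← integral_const_mul]
  refine integral_mono_ae ((L2.integrable_inner _ _).const_mul _) (L2.integrable_inner _ _) ?_
  filter_upwards [hT (wgrad v)] with x hx
  rw [hx, real_inner_smul_left]
  exact mul_le_mul_of_nonneg_right (hb _).1 real_inner_self_nonneg

theorem diffusionForm_comm (M : ℝ → ℝ) (φn : L2 G) (v w : H1 G) :
    diffusionForm M φn v w = diffusionForm M φn w v := by
  unfold diffusionForm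
  simp only [real_inner_comm]

/-- The weighted inverse Laplacian exists, by Lax–Milgram on the mean-free part of `H¹(Ω)`; testing
with mean-free functions suffices because both sides vanish on constants. -/
theorem exists_inverseLaplacian {M : ℝ → ℝ} (hM : IsAdmissibleMobility M) (φn : L2 G) :
    ∃ R : L2MeanFree G →L[ℝ] H1MeanFree G, ∀ u v, R u = v ↔ IsInverseLaplacian M φn u v := by
  obtain ⟨T, hT, c, hc, hTc⟩ := exists_mobility_operator hM φn
  obtain ⟨C, hC, h⟩ := exists_mul_norm_sq_le_of_wgrad hc fun v => hTc v.1
  -- the instances are fixed before the operators are supplied: unification does not find them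
  -- through the nested subtypes
  have hsol := @exists_solutionOperator (H1MeanFree G) (L2 G) inferInstance inferInstance
    inferInstance inferInstance inferInstance (L2MeanFree G) (L2Vec G) inferInstance inferInstance
    inferInstance inferInstance
  obtain ⟨R, hR⟩ := hsol (T.comp (wgradV G)) (wgradV G) (L2MeanFree G).subtypeL (fnV G) hC h
  refine ⟨R, fun u v => (hR u v).trans ?_⟩
  have hD : ∀ w : H1MeanFree G, (inner ℝ (T (wgrad v.1)) (wgrad w.1) = -inner ℝ u.1 (fn w.1)
      ↔ -diffusionForm M φn v.1 w.1 = ∫ x in G.domain, u.1 x * fn w.1 x) := fun w => by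
    rw [hT, integral_mul_eq_inner, neg_eq_iff_eq_neg]
  constructor
  · intro h w
    -- split `w` into its mean-free part and a constant
    set w₀ : H1MeanFree G := ⟨w - constH1 G (mean (fn w)), sub_constH1_mem w rfl⟩ with hw₀
    have h1 := (hD w₀).1 (h w₀)
    have h2 : diffusionForm M φn v.1 w₀.1 = diffusionForm M φn v.1 w := by
      rw [hT, hT, hw₀, wgrad_sub, wgrad_constH1, sub_zero]
    have h3 : ∫ x in G.domain, u.1 x * fn w₀.1 x = ∫ x in G.domain, u.1 x * fn w x := by
      rw [integral_mul_eq_inner, integral_mul_eq_inner, hw₀, fn_sub, fn_constH1, inner_sub_right,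
        inner_const_of_meanFree u.2, sub_zero]
    rw [← h2, h1, h3]
  · intro h w
    exact (hD w).2 (h w.1)

/-- Multiplication by `Hⁿ = H(φⁿ)`, with the resulting expressions for `P₁` and `g₁ⁿ`. -/
theorem exists_coeffH_operator {σ θ B : ℝ} (hσ : 0 < σ) (hσ' : σ < 1 / 2) (hθ : 1 < θ)
    (hB : ∀ s : ℝ, 0 < potential σ θ s + B) (φn Un : L2 G) :
    ∃ (T : L2 G →L[ℝ] L2 G) (γ : L2 G),
      (∀ ε (φ w : H1 G), P1Form ε σ θ B φn φ w
        = ε ^ 2 * inner ℝ (wgrad φ) (wgrad w) + 1 / 2 * inner ℝ (T (fn φ)) (T (fn w))) ∧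
      (∀ f : L2 G, ∫ x in G.domain, g1 σ θ B φn Un x * f x = inner ℝ γ f) ∧
      ∀ (c : ℝ) (f : L2 G),
        ∫ x in G.domain, (g1 σ θ B φn Un x + 1 / 2 * coeffH σ θ B (φn x) ^ 2 * c) * f x
          = inner ℝ γ f + 1 / 2 * inner ℝ (T (Lp.const 2 G.vol c)) (T f) := by
  obtain ⟨K, hK⟩ := exists_abs_coeffH_le hσ hσ' hθ hB
  have hm : AEStronglyMeasurable (fun x => coeffH σ θ B (φn x)) G.vol :=
    ((measurable_coeffH hσ hσ').comp (Lp.stronglyMeasurable φn).measurable).aestronglyMeasurable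
  obtain ⟨T, hT⟩ := exists_mul_operator (F := ℝ) hm (K := K) fun x => hK _
  set γ : L2 G := T Un - (1 / 2 : ℝ) • T (T φn)
  have hγ : γ =ᵐ[G.vol] g1 σ θ B φn Un := by
    filter_upwards [Lp.coeFn_sub (T Un) ((1 / 2 : ℝ) • T (T φn)), hT Un, hT φn, hT (T φn),
      Lp.coeFn_smul (1 / 2 : ℝ) (T (T φn))] with x h1 h2 h3 h4 h5
    rw [h1, Pi.sub_apply, h2, h5, Pi.smul_apply, h4, h3, g1]
    simp only [smul_eq_mul]
    ring
  have hg : ∀ f : L2 G, ∫ x in G.domain, g1 σ θ B φn Un x * f x = inner ℝ γ f := by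
    intro f
    rw [← integral_mul_eq_inner]
    refine integral_congr_ae ?_
    filter_upwards [hγ] with x hx
    rw [hx]
  refine ⟨T, γ, fun ε φ w => ?_, hg, fun c f => ?_⟩
  · rw [P1Form, integral_inner_eq_inner, ← integral_mul_eq_inner (T (fn φ))]
    congr 2
    refine integral_congr_ae ?_
    filter_upwards [hT (fn φ), hT (fn w)] with x h1 h2
    rw [h1, h2, smul_eq_mul, smul_eq_mul]
  · rw [← real_inner_smul_left, ← integral_mul_eq_inner γ f,
      ← integral_mul_eq_inner _ (T f), ← integral_add]
    · refine integral_congr_ae ?_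
      filter_upwards [hγ, hT f, hT (Lp.const 2 G.vol c), Lp.coeFn_const 2 G.vol c,
        Lp.coeFn_smul (1 / 2 : ℝ) (T (Lp.const 2 G.vol c))] with x h1 h2 h3 h4 h5
      rw [h5, Pi.smul_apply, h1, h2, h3, h4, Function.const_apply]
      simp only [smul_eq_mul]
      ring
    · exact (Lp.memLp γ).integrable_mul (Lp.memLp f)
    · exact (Lp.memLp _).integrable_mul (Lp.memLp _)

theorem integral_sub_div_mul {δt : ℝ} (a b f : L2 G) :
    ∫ x in G.domain, (a x - b x) / δt * f x = 1 / δt * inner ℝ (a - b) f := by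
  rw [← integral_mul_eq_inner, ← integral_const_mul]
  refine integral_congr_ae ?_
  filter_upwards [Lp.coeFn_sub a b] with x hx
  rw [hx, Pi.sub_apply]
  ring

/-- The mass balance part of the scheme says that the increment has mean zero and that the
mean-free part of `μ` is the inverse Laplacian of the increment. -/
theorem mass_equation_iff {M : ℝ → ℝ} (hM : IsAdmissibleMobility M) {δt : ℝ} (hδt : 0 < δt)
    (φn : L2 G) {R : L2MeanFree G →L[ℝ] H1MeanFree G}
    (hR : ∀ u v, R u = v ↔ IsInverseLaplacian M φn u v) (φ μ : H1 G) :
    (∀ w : H1 G, ∫ x in G.domain, (fn φ x - φn x) / δt * fn w x = -diffusionForm M φn μ w) ↔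
      ∃ (ψ : H1MeanFree G) (c : ℝ), φ = ψ.1 + constH1 G (mean φn) ∧
        μ = (R ((1 / δt) • (toL2MeanFree ψ - meanFree φn))).1 + constH1 G c := by
  obtain ⟨T, hT, -⟩ := exists_mobility_operator hM φn
  have hconst_left : ∀ (v : H1 G) c w,
      diffusionForm M φn (v + constH1 G c) w = diffusionForm M φn v w := fun v c w => by
    rw [hT, hT, wgrad_add, wgrad_constH1, add_zero]
  have hconst_right : ∀ (v : H1 G) c, diffusionForm M φn v (constH1 G c) = 0 := fun v c => by
    rw [hT, wgrad_constH1, inner_zero_right]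
  have hrhs : ∀ (ψ : H1MeanFree G) (w : H1 G), fn φ = fn ψ.1 + Lp.const 2 G.vol (mean φn) →
      ∫ x in G.domain, ((1 / δt) • (toL2MeanFree ψ - meanFree φn)).1 x * fn w x
        = ∫ x in G.domain, (fn φ x - φn x) / δt * fn w x := by
    intro ψ w h
    rw [integral_sub_div_mul, integral_mul_eq_inner, h]
    change inner ℝ ((1 / δt) • (fn ψ.1 - (φn - Lp.const 2 G.vol (mean φn)))) (fn w) = _
    rw [real_inner_smul_left]
    congr 2
    abel
  constructor
  · intro h
    have hmean : mean (fn φ) = mean φn := by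
      have h1 := h (constH1 G 1)
      rw [integral_sub_div_mul, hconst_right, neg_zero, fn_constH1, inner_sub_left,
        inner_const_right, inner_const_right, one_mul, one_mul, ← volume_mul_mean,
        ← volume_mul_mean, ← mul_sub] at h1
      have h2 : (1 / δt) ≠ 0 := (one_div_pos.2 hδt).ne'
      have h3 := (volume_real_domain_pos G).ne'
      exact sub_eq_zero.1 ((mul_eq_zero.1 ((mul_eq_zero.1 h1).resolve_left h2)).resolve_left h3)
    set ψ : H1MeanFree G := ⟨φ - constH1 G (mean φn), sub_constH1_mem φ hmean⟩
    set μ₀ : H1MeanFree G := ⟨μ - constH1 G (mean (fn μ)), sub_constH1_mem μ rfl⟩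
    have hφ : φ = ψ.1 + constH1 G (mean φn) := (sub_add_cancel _ _).symm
    have hμ : μ = μ₀.1 + constH1 G (mean (fn μ)) := (sub_add_cancel _ _).symm
    refine ⟨ψ, mean (fn μ), hφ, ?_⟩
    rw [(hR _ μ₀).2 fun w => ?_, ← hμ]
    rw [hrhs ψ w (congrArg fn hφ), h w, ← hconst_left μ₀.1 (mean (fn μ)), ← hμ]
  · rintro ⟨ψ, c, hφ, hμ⟩ w
    rw [← hrhs ψ w (congrArg fn hφ), hμ, hconst_left]
    exact ((hR _ _).1 rfl w).symm

end Scheme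

end CahnHilliardIEQ

set_option maxHeartbeats 800000 in
theorem theorem3p1 {d : ℕ} (hd : 0 < d) (G : Geometry d)
    (M : ℝ → ℝ) (hM : IsAdmissibleMobility M)
    (ε δt σ θ B : ℝ) (hε : 0 < ε) (hδt : 0 < δt) (hσ : 0 < σ) (hσ' : σ < 1 / 2) (hθ : 1 < θ)
    (hB : ∀ s : ℝ, 0 < potential σ θ s + B)
    (φn Un : L2 G) :
    -- the linear system has exactly one solution
    (∃! p : H1 G × H1 G, IsStepSolution M ε δt σ θ B φn Un p.1 p.2) ∧
    -- the mass is conserved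
    (∀ φ μ : H1 G, IsStepSolution M ε δt σ θ B φn Un φ μ →
      ∫ x in G.domain, fn φ x = ∫ x in G.domain, φn x) ∧
    -- the weighted inverse Laplacian `R` and the operator `A` of the reduced system
    ∃ (R : L2MeanFree G →L[ℝ] H1MeanFree G) (A : H1MeanFree G →L[ℝ] StrongDual ℝ (H1MeanFree G)),
      (∀ u v, R u = v ↔ IsInverseLaplacian M φn u v) ∧
      (∀ ψ χ, A ψ χ = reducedForm ε δt σ θ B φn R ψ χ) ∧
      -- the linear system is equivalent to `A ψ = b` for `ψ = φ - α`
      (∀ φ : H1 G, (∃ μ : H1 G, IsStepSolution M ε δt σ θ B φn Un φ μ) ↔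
        ∃ ψ : H1MeanFree G, fn φ = fn ψ.1 + Lp.const 2 G.vol (mean φn) ∧
          ∀ χ, A ψ χ = reducedRhs δt σ θ B φn Un R χ) ∧
      -- `A` is symmetric
      (∀ ψ χ, A ψ χ = A χ ψ) ∧
      -- `A` is positive definite, and even coercive
      (∀ ψ, ψ ≠ 0 → 0 < A ψ ψ) ∧
      (∃ C : ℝ, 0 < C ∧ ∀ ψ, C * ‖ψ‖ ^ 2 ≤ A ψ ψ) := by
  obtain ⟨R, hR⟩ := exists_inverseLaplacian hM φn
  obtain ⟨TH, γ, hP, hγ, hγc⟩ := exists_coeffH_operator (G := G) hσ hσ' hθ hB φn Un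
  obtain ⟨TM, hTM, cM, hcM, hTMc⟩ := exists_mobility_operator (G := G) hM φn
  have hvol := volume_real_domain_pos G
  set α := mean φn
  -- the operator `A` of the reduced system
  -- (as a bounded form, with the instances fixed before the operators are supplied)
  have hform := @exists_bilinearForm (H1MeanFree G) (L2 G) inferInstance inferInstance
    inferInstance inferInstance (L2Vec G) inferInstance inferInstance
  obtain ⟨A, hA₀⟩ : ∃ A : H1MeanFree G →L[ℝ] StrongDual ℝ (H1MeanFree G), ∀ ψ χ, A ψ χ
      = -(1 / δt) * inner ℝ (fn (R (toL2MeanFree ψ)).1) (fn χ.1)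
        + (ε ^ 2 * inner ℝ (wgrad ψ.1) (wgrad χ.1)
          + 1 / 2 * inner ℝ (TH (fn ψ.1)) (TH (fn χ.1))) :=
    hform (((fnV G).comp R).comp (toL2MeanFreeL G)) (fnV G) (TH.comp (fnV G)) (wgradV G)
      (-(1 / δt)) (ε ^ 2) (1 / 2)
  have hA' : ∀ ψ χ : H1MeanFree G, A ψ χ = -(1 / δt) * inner ℝ (fn (R (toL2MeanFree ψ)).1) (fn χ.1)
      + P1Form ε σ θ B φn ψ.1 χ.1 := fun ψ χ => by
    rw [hP, hA₀]
  have hA : ∀ ψ χ, A ψ χ = reducedForm ε δt σ θ B φn R ψ χ := fun ψ χ => by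
    rw [hA', reducedForm, integral_mul_eq_inner]
  -- `-(R ψ, χ)` is the weighted Dirichlet form of `R ψ` and `R χ`
  have hRform : ∀ ψ χ : H1MeanFree G, inner ℝ (fn (R (toL2MeanFree ψ)).1) (fn χ.1)
      = -diffusionForm M φn (R (toL2MeanFree χ)).1 (R (toL2MeanFree ψ)).1 := fun ψ χ => by
    have h1 := (hR (toL2MeanFree χ) _).1 rfl (R (toL2MeanFree ψ)).1
    rw [integral_mul_eq_inner] at h1
    rw [h1, real_inner_comm]
    rfl
  have hsymm : ∀ ψ χ, A ψ χ = A χ ψ := fun ψ χ => by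
    rw [hA', hA', hRform, hRform, diffusionForm_comm, hP, hP, real_inner_comm (wgrad ψ.1),
      real_inner_comm (TH (fn ψ.1))]
  have hcoer : ∃ C : ℝ, 0 < C ∧ ∀ ψ, C * ‖ψ‖ ^ 2 ≤ A ψ ψ := by
    refine exists_mul_norm_sq_le_of_wgrad (c := ε ^ 2) (by positivity) fun ψ => ?_
    rw [hA', hRform, hP, hTM, real_inner_self_eq_norm_sq, real_inner_self_eq_norm_sq]
    have h1 : 0 ≤ inner ℝ (TM (wgrad (R (toL2MeanFree ψ)).1)) (wgrad (R (toL2MeanFree ψ)).1) :=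
      le_trans (by positivity) (hTMc _)
    have h2 := mul_nonneg (one_div_pos.2 hδt).le h1
    have h3 := sq_nonneg ‖TH (fn ψ.1)‖
    linarith
  -- the right-hand side of the reduced system
  have hb : ∀ χ, reducedRhs δt σ θ B φn Un R χ
      = -inner ℝ (fn (R ((1 / δt) • meanFree φn)).1) (fn χ.1)
        - (inner ℝ γ (fn χ.1) + 1 / 2 * inner ℝ (TH (Lp.const 2 G.vol α)) (TH (fn χ.1))) :=
    fun χ => by rw [reducedRhs, integral_mul_eq_inner, hγc]
  have hsolve : ∃! ψ : H1MeanFree G, ∀ χ, A ψ χ = reducedRhs δt σ θ B φn Un R χ := by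
    obtain ⟨C, hC, h⟩ := hcoer
    have huniq := @existsUnique_of_coercive (H1MeanFree G) (L2 G) inferInstance inferInstance
      inferInstance inferInstance inferInstance
    have h1 := huniq (A := A) hC h (fnV G) (TH.comp (fnV G))
      (-(fn (R ((1 / δt) • meanFree φn)).1) - γ)
      ((-(1 / 2 : ℝ)) • TH (Lp.const 2 G.vol α))
    refine (existsUnique_congr fun ψ => forall_congr' fun χ => ?_).1 h1
    have h2 : inner ℝ (-(fn (R ((1 / δt) • meanFree φn)).1) - γ) (fn χ.1)
        + inner ℝ ((-(1 / 2 : ℝ)) • TH (Lp.const 2 G.vol α)) (TH (fn χ.1))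
        = reducedRhs δt σ θ B φn Un R χ := by
      rw [hb, inner_sub_left, inner_neg_left, real_inner_smul_left]
      ring
    rw [← h2]
    rfl
  -- the constant part of `μ`, determined by testing with `1`
  obtain ⟨κ, hκ⟩ : ∃ κ : H1MeanFree G → ℝ, ∀ ψ, κ ψ
      = (P1Form ε σ θ B φn (ψ.1 + constH1 G α) (constH1 G 1)
        + inner ℝ γ (Lp.const 2 G.vol (1 : ℝ))) / volume.real G.domain := ⟨_, fun _ => rfl⟩
  obtain ⟨sol, hsol⟩ : ∃ sol : H1MeanFree G → H1 G × H1 G, ∀ ψ, sol ψ = (ψ.1 + constH1 G α,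
    (R ((1 / δt) • (toL2MeanFree ψ - meanFree φn))).1 + constH1 G (κ ψ)) := ⟨_, fun _ => rfl⟩
  -- linear expansions in the test function and in `φ = ψ + α`
  have hP_add : ∀ φ w₁ w₂ : H1 G, P1Form ε σ θ B φn φ (w₁ + w₂)
      = P1Form ε σ θ B φn φ w₁ + P1Form ε σ θ B φn φ w₂ := fun φ w₁ w₂ => by
    rw [hP, hP, hP, wgrad_add, fn_add, TH.map_add, inner_add_right, inner_add_right]
    ring
  have hP_shift : ∀ ψ χ : H1MeanFree G, P1Form ε σ θ B φn (ψ.1 + constH1 G α) χ.1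
      = P1Form ε σ θ B φn ψ.1 χ.1
        + 1 / 2 * inner ℝ (TH (Lp.const 2 G.vol α)) (TH (fn χ.1)) := fun ψ χ => by
    rw [hP, hP, wgrad_add, wgrad_constH1, add_zero, fn_add, fn_constH1, TH.map_add,
      inner_add_left]
    ring
  have hR_inner : ∀ ψ χ : H1MeanFree G,
      inner ℝ (fn (R ((1 / δt) • (toL2MeanFree ψ - meanFree φn))).1) (fn χ.1)
        = 1 / δt * inner ℝ (fn (R (toL2MeanFree ψ)).1) (fn χ.1)
          - inner ℝ (fn (R ((1 / δt) • meanFree φn)).1) (fn χ.1) := fun ψ χ => by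
    have h1 : R ((1 / δt) • (toL2MeanFree ψ - meanFree φn))
        = (1 / δt) • R (toL2MeanFree ψ) - R ((1 / δt) • meanFree φn) :=
      (congrArg R (smul_sub _ _ _)).trans ((R.map_sub _ _).trans
        (congrArg (· - R ((1 / δt) • meanFree φn)) (R.map_smul _ _)))
    rw [h1]
    change inner ℝ ((1 / δt) • fn (R (toL2MeanFree ψ)).1 - fn (R ((1 / δt) • meanFree φn)).1)
      (fn χ.1) = _
    rw [inner_sub_left, real_inner_smul_left]
  have hfn_add : ∀ (v : H1 G) c, fn (v + constH1 G c) = fn v + Lp.const 2 G.vol c :=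
    fun v c => rfl
  have hconst_inner : ∀ a c : ℝ, inner ℝ (Lp.const 2 G.vol a) (Lp.const 2 G.vol c)
      = c * (volume.real G.domain * a) := fun a c => by
    rw [inner_const_right, integral_Lp_const]
  have hinner_mf : ∀ (a : ℝ) (χ : H1MeanFree G), inner ℝ (Lp.const 2 G.vol a) (fn χ.1) = 0 :=
    fun a χ => by rw [real_inner_comm, inner_const_of_meanFree (fn_mem_L2MeanFree χ)]
  have hmain : ∀ φ μ : H1 G, IsStepSolution M ε δt σ θ B φn Un φ μ ↔
      ∃ ψ : H1MeanFree G, (∀ χ, A ψ χ = reducedRhs δt σ θ B φn Un R χ) ∧ (φ, μ) = sol ψ := by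
    intro φ μ
    rw [IsStepSolution, mass_equation_iff hM hδt φn hR]
    -- the second equation, tested with mean-free functions
    have hmf : ∀ (ψ : H1MeanFree G) (c : ℝ) (χ : H1MeanFree G),
        φ = ψ.1 + constH1 G α →
        μ = (R ((1 / δt) • (toL2MeanFree ψ - meanFree φn))).1 + constH1 G c →
        (inner ℝ (fn μ) (fn χ.1) = P1Form ε σ θ B φn φ χ.1 + inner ℝ γ (fn χ.1) ↔
          A ψ χ = reducedRhs δt σ θ B φn Un R χ) := by
      intro ψ c χ hφ hμ
      rw [hφ, hμ, hfn_add, inner_add_left, hinner_mf, hR_inner, hP_shift, hA', hb]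
      constructor <;> intro h <;> linarith
    -- the second equation, tested with `1`
    have hone : ∀ (ψ : H1MeanFree G) (c : ℝ), φ = ψ.1 + constH1 G α →
        μ = (R ((1 / δt) • (toL2MeanFree ψ - meanFree φn))).1 + constH1 G c →
        (inner ℝ (fn μ) (fn (constH1 G 1)) = P1Form ε σ θ B φn φ (constH1 G 1)
          + inner ℝ γ (fn (constH1 G 1)) ↔ c = κ ψ) := by
      intro ψ c hφ hμ
      rw [hμ, hfn_add, inner_add_left, fn_constH1,
        inner_const_of_meanFree (fn_mem_L2MeanFree _), hconst_inner, hφ, hκ, eq_div_iff hvol.ne']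
      constructor <;> intro h <;> linarith
    simp only [integral_mul_eq_inner, hγ]
    constructor
    · rintro ⟨⟨ψ, c, hφ, hμ⟩, h2⟩
      have hc := (hone ψ c hφ hμ).1 (h2 _)
      refine ⟨ψ, fun χ => (hmf ψ c χ hφ hμ).1 (h2 χ.1), ?_⟩
      rw [hsol, hφ, hμ, hc]
    · rintro ⟨ψ, hψ, hs⟩
      have hφ : φ = ψ.1 + constH1 G α := congrArg Prod.fst (hs.trans (hsol ψ))
      have hμ := congrArg Prod.snd (hs.trans (hsol ψ))
      refine ⟨⟨ψ, κ ψ, hφ, hμ⟩, fun w => ?_⟩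
      set χ : H1MeanFree G := ⟨w - constH1 G (mean (fn w)), sub_constH1_mem w rfl⟩
      obtain ⟨c, hw⟩ : ∃ c : ℝ, w = χ.1 + c • constH1 G 1 := by
        refine ⟨mean (fn w), fn_injective G ?_⟩
        have h1 : w = χ.1 + constH1 G (mean (fn w)) := (sub_add_cancel _ _).symm
        have h2 : (Lp.const 2 G.vol (mean (fn w)) : L2 G)
            = mean (fn w) • Lp.const 2 G.vol (1 : ℝ) := by
          have := (Lp.constₗ 2 G.vol ℝ (E := ℝ)).map_smul (mean (fn w)) 1
          simpa using this
        conv_lhs => rw [h1]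
        rw [hfn_add, h2]
        rfl
      have hP_smul : ∀ c : ℝ, P1Form ε σ θ B φn φ (c • constH1 G 1)
          = c * P1Form ε σ θ B φn φ (constH1 G 1) := fun c => by
        rw [hP, hP, wgrad_smul, fn_smul, TH.map_smul, real_inner_smul_right,
          real_inner_smul_right]
        ring
      have e1 := (hmf ψ (κ ψ) χ hφ hμ).2 (hψ χ)
      have e2 := (hone ψ (κ ψ) hφ hμ).2 rfl
      have hfw : fn w = fn χ.1 + c • fn (constH1 G 1) := congrArg fn hw
      have hPw := congrArg (P1Form ε σ θ B φn φ) hw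
      rw [hP_add, hP_smul] at hPw
      rw [hPw, hfw, inner_add_right, inner_add_right, real_inner_smul_right,
        real_inner_smul_right, e1, e2]
      ring
  obtain ⟨ψ₀, hψ₀, huniq⟩ := hsolve
  refine ⟨⟨sol ψ₀, (hmain _ _).2 ⟨ψ₀, hψ₀, rfl⟩, ?_⟩, ?_, R, A, hR, hA, ?_, hsymm, ?_, hcoer⟩
  · rintro ⟨φ, μ⟩ h
    obtain ⟨ψ, hψ, hs⟩ := (hmain φ μ).1 h
    rw [hs, huniq ψ hψ]
  · intro φ μ h
    obtain ⟨ψ, -, hs⟩ := (hmain φ μ).1 h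
    have hφ : φ = ψ.1 + constH1 G α := congrArg Prod.fst (hs.trans (hsol ψ))
    have h1 := inner_const_right (fn φ) 1
    rw [one_mul] at h1
    rw [← h1, hφ, hfn_add, inner_add_left, inner_const_of_meanFree (fn_mem_L2MeanFree ψ),
      hconst_inner, zero_add, one_mul, volume_mul_mean]
  · intro φ
    constructor
    · rintro ⟨μ, h⟩
      obtain ⟨ψ, hψ, hs⟩ := (hmain φ μ).1 h
      exact ⟨ψ, congrArg (fun p => fn p.1) (hs.trans (hsol ψ)), hψ⟩
    · rintro ⟨ψ, hφ, h⟩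
      refine ⟨(sol ψ).2, (hmain _ _).2 ⟨ψ, h, Prod.ext (fn_injective G ?_) rfl⟩⟩
      rw [hsol]
      exact hφ
  · intro ψ hψ
    obtain ⟨C, hC, h⟩ := hcoer
    have : 0 < ‖ψ‖ := norm_pos_iff.2 hψ
    exact lt_of_lt_of_le (by positivity) (h ψ)
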